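/- **Theorem.** Let $\mathbb D$ be the open unit disk, $\mathbb T$ the unit circle, and $m$ the normalized Lebesgue measure on $\mathbb T$. Let $p>1$ and put $$A_p=p\int_0^1\frac{t^{p-1}}{\sin(\pi t/2)}\,dt ,$$ which is a convergent integral. (a) Let $F$ be a function in the Hardy space $H^1(\mathbb D)$, that is, $F$ is analytic in $\mathbb D$ and $\sup_{0\le r<1}\int_{\mathbb T}|F(r\zeta)|\,dm(\zeta)<\infty$. Let $u,v:\mathbb T\to\mathbb R$ be such that $u+iv$ are the radial boundary values of $F$, i.e. $\lim_{r\to1^-}F(r\zeta)=u(\zeta)+iv(\zeta)$ for almost every $\zeta\in\mathbb T$. Let $B\in\mathbb R$, and suppose that $u\ge 0$ and $|v|\le B$ almost everywhere on $\mathbb T$, and that $\int_{\mathbb T}v\,dm=0$. Then $u$ and $|v|^p$ are integrable and $$\int_{\mathbb T}|v|^p\,dm\le A_p\,B^{p-1}\int_{\mathbb T}u\,dm .$$ (b) The constant $A_p$ is best possible: for every $B>0$ and every real $C<A_p$ there are $F,u,v$ satisfying all the hypotheses of (a) with this $B$, such that $$\int_{\mathbb T}|v|^p\,dm> C\,B^{p-1}\int_{\mathbb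 T}u\,dm .$$ -/

import Mathlib

open Filter Topology MeasureTheory

noncomputable section

/-- The unit circle `𝕋`, parametrised by the angle `t` modulo `2π`. -/
abbrev UnitCircleAngle : Type := AddCircle (2 * Real.pi)

/-- Normalized Lebesgue measure `m` on the unit circle (total mass `1`). -/
abbrev circleMeasure : Measure UnitCircleAngle :=
  haveI : Fact (0 < 2 * Real.pi) := ⟨Real.two_pi_pos⟩
  AddCircle.haarAddCircle

/-- The point `r e^{it}` of the complex plane. -/
def polarPoint (r : ℝ) (t : UnitCircleAngle) : ℂ := (r : ℂ) * (AddCircle.toCircle t : ℂ)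

/-- `F` belongs to the Hardy space `H¹` of the unit disk: it is analytic there and its integral
means over the circles of radius `r < 1` are bounded. -/
structure IsHardyOne (F : ℂ → ℂ) : Prop where
  analytic : AnalyticOnNhd ℂ F (Metric.ball 0 1)
  bounded_means : ∃ M : ℝ, ∀ r : ℝ, 0 ≤ r → r < 1 →
    ∫ t, ‖F (polarPoint r t)‖ ∂circleMeasure ≤ M

/-- `F` has radial boundary values `u + iv` at almost every point of the unit circle. -/
def HasRadialBoundaryValues (F : ℂ → ℂ) (u v : UnitCircleAngle → ℝ) : Prop :=
  ∀ᵐ t ∂circleMeasure,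
    Tendsto (fun r : ℝ => F (polarPoint r t)) (𝓝[<] 1) (𝓝 ((u t : ℂ) + (v t : ℂ) * Complex.I))

/-- `F ∈ H¹` has boundary values `u + iv` with `u ≥ 0` and `|v| ≤ B` almost everywhere
and `∫ v dm = 0`. -/
structure IsHalfStripFunction (B : ℝ) (F : ℂ → ℂ) (u v : UnitCircleAngle → ℝ) : Prop where
  hardy : IsHardyOne F
  boundary : HasRadialBoundaryValues F u v
  re_nonneg : ∀ᵐ t ∂circleMeasure, 0 ≤ u t
  im_bound : ∀ᵐ t ∂circleMeasure, |v t| ≤ B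
  im_mean : ∫ t, v t ∂circleMeasure = 0

/-- `A_p = p ∫₀¹ t^{p-1} / sin(π t / 2) dt`. -/
def sharpConst (p : ℝ) : ℝ :=
  p * ∫ t in (0 : ℝ)..1, t ^ (p - 1) / Real.sin (Real.pi * t / 2)

end

/-! After scaling by `B`, the values of `F` should lie in the half strip Re > 0, |Im| < 1, which g ↦
sinh(πg/2) carries onto the right half plane. There, by layer cake, the bounded harmonic function
with boundary values |Im g|^p is Φ(w) = ∫₀¹ p t^(p-1) ω_t(w) dt, with ω_t the harmonic measure of
{is : |s| > sin(πt/2)} (`rayMeasure`, `stripPotential`).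

Part (a) rests on two estimates for Φ. First, Φ(sinh(πg/2)) ≥ |Im g|^p inside the strip
(`abs_im_rpow_le_stripPotential`): the mean of arg(sinh ζ + i sin θ) over θ is Im ζ, which yields
|Im g| ≤ ∫ω_t dt, and a bathtub argument upgrades this to the power p. Second, Φ(sinh(πx/2)) ≤ A_p x
for x > 0 (`stripPotential_sinh_le`), because ω_t is (2/π) arctan(·/sin(πt/2)) on the real axis and
arctan(sinh a / c) ≤ a/c. As F(0) = ∫u is real, the mean value property of Φ along circles turns
these into the inequality on each radius r < 1, and r → 1 is bounded convergence.

The hypotheses concern boundary values only; they reach the interior because an H¹ function is the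
Poisson integral of its boundary values (`IsHardyOne.eq_integral_boundary`). This comes from
subharmonicity of |F|^(1/2): bounded L¹ means of |F| bound |F|^(1/2) in L², hence make it uniformly
integrable.

For (b), let `F` map the disk conformally onto the half strip, with F(0) small. Then Φ has boundary
values exactly |v|^p after scaling (`tendsto_stripPotential`), so the first estimate loses nothing
in the mean, and the second is asymptotically sharp because Φ has slope (2/π)A_p at the origin
(`tendsto_stripPotential_div`). -/

/-! ### Points of the circle and the Poisson kernel -/

@[fun_prop]
theorem continuous_polarPoint (r : ℝ) : Continuous (polarPoint r) := by
  unfold polarPoint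
  exact continuous_const.mul (continuous_subtype_val.comp AddCircle.continuous_toCircle)

theorem norm_polarPoint (r : ℝ) (t : UnitCircleAngle) : ‖polarPoint r t‖ = |r| := by
  simp [polarPoint, Circle.norm_coe]

theorem polarPoint_eq_mul (r : ℝ) (t : UnitCircleAngle) : polarPoint r t = r * polarPoint 1 t := by
  simp [polarPoint]

theorem polarPoint_mem_ball {r : ℝ} (h0 : 0 ≤ r) (h1 : r < 1) (t : UnitCircleAngle) :
    polarPoint r t ∈ Metric.ball (0 : ℂ) 1 := by
  simp [norm_polarPoint, abs_of_nonneg h0, h1]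

instance isProbabilityMeasure_circleMeasure : IsProbabilityMeasure circleMeasure := by
  have : Fact (0 < 2 * Real.pi) := ⟨Real.two_pi_pos⟩
  change IsProbabilityMeasure AddCircle.haarAddCircle
  infer_instance

instance compactSpace_unitCircleAngle : CompactSpace UnitCircleAngle := by
  have : Fact (0 < 2 * Real.pi) := ⟨Real.two_pi_pos⟩
  infer_instance

theorem integral_circleMeasure_eq_circleAverage {E : Type*} [NormedAddCommGroup E]
    [NormedSpace ℝ E] (f : ℂ → E) :
    ∫ t, f (polarPoint 1 t) ∂circleMeasure = Real.circleAverage f 0 1 := by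
  have : Fact (0 < 2 * Real.pi) := ⟨Real.two_pi_pos⟩
  change ∫ t, f (polarPoint 1 t) ∂AddCircle.haarAddCircle = _
  rw [AddCircle.integral_haarAddCircle, Real.circleAverage,
    ← AddCircle.intervalIntegral_preimage (2 * Real.pi) 0]
  simp [polarPoint, AddCircle.toCircle, circleMap]

theorem Continuous.integrable_circleMeasure {E : Type*} [NormedAddCommGroup E]
    {f : UnitCircleAngle → E} (hf : Continuous f) : Integrable f circleMeasure :=
  hf.integrable_of_hasCompactSupport (HasCompactSupport.of_compactSpace f)

/-- The Poisson kernel of the unit disk at `w`, as a function of the angle. -/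
noncomputable def circlePoisson (w : ℂ) (t : UnitCircleAngle) : ℝ := poissonKernel 0 w (polarPoint 1 t)

theorem circlePoisson_eq (w : ℂ) (t : UnitCircleAngle) :
    circlePoisson w t = (1 - ‖w‖ ^ 2) / ‖polarPoint 1 t - w‖ ^ 2 := by
  simp [circlePoisson, poissonKernel_def, norm_polarPoint]

theorem polarPoint_one_sub_ne_zero {w : ℂ} (hw : ‖w‖ < 1) (t : UnitCircleAngle) :
    polarPoint 1 t - w ≠ 0 := by
  intro h
  have := norm_polarPoint 1 t
  rw [sub_eq_zero.1 h] at this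
  norm_num at this
  linarith

theorem circlePoisson_nonneg {w : ℂ} (hw : ‖w‖ < 1) (t : UnitCircleAngle) :
    0 ≤ circlePoisson w t := by
  rw [circlePoisson_eq]
  have : 0 ≤ ‖w‖ := norm_nonneg w
  exact div_nonneg (by nlinarith) (by positivity)

theorem continuous_circlePoisson {w : ℂ} (hw : ‖w‖ < 1) : Continuous (circlePoisson w) := by
  simp_rw [funext (circlePoisson_eq w)]
  refine continuous_const.div (((continuous_polarPoint 1).sub continuous_const).norm.pow 2) ?_
  intro t
  simpa using polarPoint_one_sub_ne_zero hw t

theorem circlePoisson_zero (t : UnitCircleAngle) : circlePoisson 0 t = 1 := by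
  simp [circlePoisson_eq, norm_polarPoint]

theorem exists_circlePoisson_le {w : ℂ} (hw : ‖w‖ < 1) : ∃ C, 0 < C ∧ ∀ t, circlePoisson w t ≤ C := by
  obtain ⟨C, hC⟩ := isCompact_univ.bddAbove_image (continuous_circlePoisson hw).continuousOn
  exact ⟨max C 1, by positivity, fun t => le_max_of_le_left (hC ⟨t, trivial, rfl⟩)⟩

theorem DiffContOnCl.eq_integral_circlePoisson {f : ℂ → ℂ}
    (hf : DiffContOnCl ℂ f (Metric.ball 0 1)) {w : ℂ} (hw : ‖w‖ < 1) :
    f w = ∫ t, (circlePoisson w t : ℂ) * f (polarPoint 1 t) ∂circleMeasure := by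
  rw [← hf.circleAverage_poissonKernel_smul (w := w) (by simpa using hw),
    ← integral_circleMeasure_eq_circleAverage]
  simp [circlePoisson]

theorem integral_circlePoisson {w : ℂ} (hw : ‖w‖ < 1) :
    ∫ t, circlePoisson w t ∂circleMeasure = 1 := by
  have := (diffContOnCl_const (c := (1 : ℂ)) (𝕜 := ℂ)
    (s := Metric.ball (0 : ℂ) 1)).eq_integral_circlePoisson hw
  simp only [mul_one] at this
  rw [integral_complex_ofReal] at this
  exact_mod_cast this.symm

/-- The distances |e^{it} - re^{is}| and |e^{is} - re^{it}| agree. After Fubini this allows the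
kernel to be integrated in the interior angle instead of the boundary angle. -/
theorem circlePoisson_polarPoint_comm (r : ℝ) (s t : UnitCircleAngle) :
    circlePoisson (polarPoint r s) t = circlePoisson (polarPoint r t) s := by
  simp only [circlePoisson_eq, norm_polarPoint]
  congr 1
  have key : ∀ a b : ℂ, ‖a‖ = 1 → ‖b‖ = 1 → ‖a - r * b‖ ^ 2 = 1 + r ^ 2 - 2 * r * (a.re * b.re + a.im * b.im) := by
    intro a b ha hb
    have h1 : a.re * a.re + a.im * a.im = 1 := by
      rw [← Complex.normSq_apply, Complex.normSq_eq_norm_sq, ha]; norm_num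
    have h2 : b.re * b.re + b.im * b.im = 1 := by
      rw [← Complex.normSq_apply, Complex.normSq_eq_norm_sq, hb]; norm_num
    rw [← Complex.normSq_eq_norm_sq, Complex.normSq_apply]
    simp
    linear_combination h1 + r ^ 2 * h2
  rw [polarPoint_eq_mul r s, polarPoint_eq_mul r t,
    key _ _ (by simp [norm_polarPoint]) (by simp [norm_polarPoint]),
    key _ _ (by simp [norm_polarPoint]) (by simp [norm_polarPoint])]
  ring

theorem continuous_circlePoisson_polarPoint {r : ℝ} (h0 : 0 ≤ r) (h1 : r < 1) :
    Continuous fun x : UnitCircleAngle × UnitCircleAngle => circlePoisson (polarPoint r x.1) x.2 := by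
  simp_rw [circlePoisson_eq, norm_polarPoint]
  refine continuous_const.div ?_ ?_
  · exact ((((continuous_polarPoint 1).comp continuous_snd).sub
      ((continuous_polarPoint r).comp continuous_fst)).norm.pow 2)
  · intro x
    have : ‖polarPoint r x.1‖ < 1 := by simpa using polarPoint_mem_ball h0 h1 x.1
    simpa using polarPoint_one_sub_ne_zero this x.2

theorem AnalyticOnNhd.diffContOnCl_comp_mul {F : ℂ → ℂ}
    (hF : AnalyticOnNhd ℂ F (Metric.ball 0 1)) {r : ℝ} (h0 : 0 ≤ r) (h1 : r < 1) :
    DiffContOnCl ℂ (fun z => F (r * z)) (Metric.ball 0 1) := by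
  apply DifferentiableOn.diffContOnCl
  intro z hz
  have hz' : ‖z‖ ≤ 1 := by simpa using Metric.closure_ball_subset_closedBall hz
  have : (r : ℂ) * z ∈ Metric.ball (0 : ℂ) 1 := by
    simp only [mem_ball_zero_iff, norm_mul, Complex.norm_real, Real.norm_eq_abs, abs_of_nonneg h0]
    nlinarith [norm_nonneg z]
  exact ((hF _ this).differentiableAt.comp z (by fun_prop)).differentiableWithinAt

theorem AnalyticOnNhd.continuous_comp_polarPoint {F : ℂ → ℂ}
    (hF : AnalyticOnNhd ℂ F (Metric.ball 0 1)) {r : ℝ} (h0 : 0 ≤ r) (h1 : r < 1) :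
    Continuous fun t => F (polarPoint r t) :=
  hF.continuousOn.comp_continuous (continuous_polarPoint r) fun t => polarPoint_mem_ball h0 h1 t

theorem AnalyticOnNhd.eq_integral_circlePoisson {F : ℂ → ℂ}
    (hF : AnalyticOnNhd ℂ F (Metric.ball 0 1)) {r : ℝ} (h0 : 0 ≤ r) (h1 : r < 1)
    {w : ℂ} (hw : ‖w‖ < 1) :
    F (r * w) = ∫ t, (circlePoisson w t : ℂ) * F (polarPoint r t) ∂circleMeasure := by
  simpa only [← polarPoint_eq_mul] using (hF.diffContOnCl_comp_mul h0 h1).eq_integral_circlePoisson hw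

/-! ### Subharmonicity of |f|^(1/2) -/

/-- Every continuous real function on the circle is a uniform limit of real parts of entire
functions. -/
theorem exists_differentiable_re_close (ψ : C(UnitCircleAngle, ℝ)) {δ : ℝ} (hδ : 0 < δ) :
    ∃ q : ℂ → ℂ, Differentiable ℂ q ∧ ∀ t, |ψ t - (q (polarPoint 1 t)).re| < δ := by
  have : Fact (0 < 2 * Real.pi) := ⟨Real.two_pi_pos⟩
  let φ : C(UnitCircleAngle, ℂ) := ⟨fun t => (ψ t : ℂ), by fun_prop⟩
  have hφ : φ ∈ (Submodule.span ℂ (Set.range (@fourier (2 * Real.pi)))).topologicalClosure := by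
    rw [span_fourier_closure_eq_top]; trivial
  obtain ⟨g, hg, hgφ⟩ := Metric.mem_closure_iff.1 hφ δ hδ
  -- On the circle negative frequencies are conjugates of positive powers, and dropping a
  -- conjugation does not alter the real part; so q₁ + q₂ will serve.
  have key : ∀ g ∈ Submodule.span ℂ (Set.range (@fourier (2 * Real.pi))),
      ∃ q₁ q₂ : ℂ → ℂ, Differentiable ℂ q₁ ∧ Differentiable ℂ q₂ ∧
        ∀ t, g t = q₁ (polarPoint 1 t) + starRingEnd ℂ (q₂ (polarPoint 1 t)) := by
    intro g hg
    induction hg using Submodule.span_induction with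
    | mem x hx =>
      obtain ⟨n, rfl⟩ := hx
      obtain ⟨k, rfl | rfl⟩ := n.eq_nat_or_neg
      · refine ⟨fun z => z ^ k, fun _ => 0, by fun_prop, by fun_prop, fun t => ?_⟩
        simp [polarPoint, fourier_apply, AddCircle.toCircle_nsmul]
      · refine ⟨fun _ => 0, fun z => z ^ k, by fun_prop, by fun_prop, fun t => ?_⟩
        rw [fourier_neg]
        simp [polarPoint, fourier_apply, AddCircle.toCircle_nsmul]
    | zero => exact ⟨fun _ => 0, fun _ => 0, by fun_prop, by fun_prop, by simp⟩
    | add x y _ _ hx hy =>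
      obtain ⟨a, b, ha, hb, hab⟩ := hx
      obtain ⟨c, d, hc, hd, hcd⟩ := hy
      refine ⟨fun z => a z + c z, fun z => b z + d z, by fun_prop, by fun_prop, fun t => ?_⟩
      simp [hab, hcd]; ring
    | smul k x _ hx =>
      obtain ⟨a, b, ha, hb, hab⟩ := hx
      refine ⟨fun z => k * a z, fun z => starRingEnd ℂ k * b z, by fun_prop, by fun_prop,
        fun t => ?_⟩
      simp [hab]; ring
  obtain ⟨a, b, ha, hb, hab⟩ := key g hg
  refine ⟨fun z => a z + b z, by fun_prop, fun t => ?_⟩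
  have h1 : (g t).re = (a (polarPoint 1 t) + b (polarPoint 1 t)).re := by simp [hab]
  rw [← h1]
  calc |ψ t - (g t).re| = |(φ t - g t).re| := by simp [φ]
    _ ≤ ‖φ t - g t‖ := Complex.abs_re_le_norm _
    _ = dist (φ t) (g t) := (dist_eq_norm _ _).symm
    _ ≤ dist φ g := ContinuousMap.dist_apply_le_dist t
    _ < δ := hgφ

/-- Subharmonicity of `|f|^{1/2}` in the form of a Poisson integral inequality. -/
theorem DiffContOnCl.sqrt_norm_le_integral_circlePoisson {f : ℂ → ℂ}
    (hf : DiffContOnCl ℂ f (Metric.ball 0 1)) {w : ℂ} (hw : ‖w‖ < 1) :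
    √‖f w‖ ≤ ∫ t, circlePoisson w t * √‖f (polarPoint 1 t)‖ ∂circleMeasure := by
  have hfc : Continuous fun t : UnitCircleAngle => f (polarPoint 1 t) := by
    refine hf.continuousOn.comp_continuous (continuous_polarPoint 1) fun t => ?_
    rw [closure_ball _ one_ne_zero]
    simp [norm_polarPoint]
  have hPc := continuous_circlePoisson hw
  set J := ∫ t, circlePoisson w t * √‖f (polarPoint 1 t)‖ ∂circleMeasure with hJ
  have main : ∀ ε > 0, √‖f w‖ ≤ Real.exp (2 * ε) * (J + ε) := by
    intro ε hε
    have hsc : Continuous fun t : UnitCircleAngle => √‖f (polarPoint 1 t)‖ :=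
      Real.continuous_sqrt.comp hfc.norm
    -- The ε keeps the logarithm finite at zeros of f. Then exp q is a zero-free analytic function
    -- whose modulus on the circle is √|f| + ε up to a factor within e^{±ε}.
    let ψ : C(UnitCircleAngle, ℝ) := ⟨fun t => Real.log (√‖f (polarPoint 1 t)‖ + ε), by
      refine Continuous.log (by fun_prop) fun t => ?_
      positivity⟩
    obtain ⟨q, hq, hψ⟩ := exists_differentiable_re_close ψ hε
    have hexp : ∀ t, Real.exp (ψ t) = √‖f (polarPoint 1 t)‖ + ε := fun t =>
      Real.exp_log (by positivity)
    -- Maximum principle: on the circle |f| ≤ e^{2ψ}, and Re q differs from ψ by less than ε.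
    have h1 : ‖f w * Complex.exp (-2 * q w)‖ ≤ Real.exp (2 * ε) := by
      have hd : DiffContOnCl ℂ (fun z => f z * Complex.exp (-2 * q z)) (Metric.ball 0 1) := by
        refine hf.smul (?_ : DiffContOnCl ℂ (fun z => Complex.exp (-2 * q z)) _)
        exact Differentiable.diffContOnCl (by fun_prop)
      refine Complex.norm_le_of_forall_mem_frontier_norm_le Metric.isBounded_ball hd ?_
        (z := w) (subset_closure (by simpa using hw))
      intro z hz
      rw [frontier_ball _ one_ne_zero, mem_sphere_zero_iff_norm] at hz
      obtain ⟨t, rfl⟩ : ∃ t, polarPoint 1 t = z := by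
        obtain ⟨t, ht⟩ := (AddCircle.homeomorphCircle (T := 2 * Real.pi)
          (by positivity)).surjective ⟨z, mem_sphere_zero_iff_norm.2 hz⟩
        refine ⟨t, ?_⟩
        rw [AddCircle.homeomorphCircle_apply] at ht
        simp [polarPoint, ht]
      rw [norm_mul, Complex.norm_exp]
      have h2 : √‖f (polarPoint 1 t)‖ ≤ Real.exp (ψ t) := by rw [hexp]; linarith
      have h3 : ‖f (polarPoint 1 t)‖ ≤ Real.exp (2 * ψ t) := by
        rw [two_mul, Real.exp_add, ← Real.mul_self_sqrt (norm_nonneg (f (polarPoint 1 t)))]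
        gcongr
      calc _ ≤ Real.exp (2 * ψ t) * Real.exp (-2 * q (polarPoint 1 t)).re := by gcongr
        _ = Real.exp (2 * (ψ t - (q (polarPoint 1 t)).re)) := by
          rw [← Real.exp_add]; congr 1; simp; ring
        _ ≤ _ := by
          gcongr
          exact (le_abs_self _).trans (hψ t).le
    have h2 : √‖f w‖ ≤ Real.exp ε * ‖Complex.exp (q w)‖ := by
      refine Real.sqrt_le_iff.2 ⟨by positivity, ?_⟩
      have e : f w = f w * Complex.exp (-2 * q w) * (Complex.exp (q w) * Complex.exp (q w)) := by
        rw [← Complex.exp_add, mul_assoc, ← Complex.exp_add]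
        ring_nf
        simp
      rw [e, norm_mul, norm_mul (Complex.exp _)]
      calc _ ≤ Real.exp (2 * ε) * (‖Complex.exp (q w)‖ * ‖Complex.exp (q w)‖) := by gcongr
        _ = _ := by rw [two_mul, Real.exp_add]; ring
    -- The Poisson formula for exp q, whose modulus on the circle is at most e^ε(√|f| + ε).
    have h3 : ‖Complex.exp (q w)‖ ≤ Real.exp ε * (J + ε) := by
      have hd : DiffContOnCl ℂ (fun z => Complex.exp (q z)) (Metric.ball 0 1) :=
        Differentiable.diffContOnCl (by fun_prop)
      rw [hd.eq_integral_circlePoisson hw]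
      refine (norm_integral_le_integral_norm _).trans ?_
      have e1 : Real.exp ε * (J + ε) = ∫ t, Real.exp ε * (circlePoisson w t * √‖f (polarPoint 1 t)‖
          + circlePoisson w t * ε) ∂circleMeasure := by
        rw [integral_const_mul, integral_add, integral_mul_const, integral_circlePoisson hw, one_mul]
        · exact Continuous.integrable_circleMeasure (by fun_prop)
        · exact Continuous.integrable_circleMeasure (by fun_prop)
      rw [e1]
      have hqc := hq.continuous
      have hpc := continuous_polarPoint 1
      refine integral_mono (Continuous.integrable_circleMeasure (by fun_prop))
        (Continuous.integrable_circleMeasure (by fun_prop)) fun t => ?_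
      have hP := circlePoisson_nonneg hw t
      simp only [norm_mul, Complex.norm_real, Real.norm_eq_abs, abs_of_nonneg hP, Complex.norm_exp]
      have : (q (polarPoint 1 t)).re ≤ ε + ψ t := by
        have := (abs_lt.1 (hψ t)).1
        linarith
      calc _ ≤ circlePoisson w t * Real.exp (ε + ψ t) := by gcongr
        _ = _ := by rw [Real.exp_add, hexp]; ring
    calc _ ≤ Real.exp ε * (Real.exp ε * (J + ε)) := h2.trans (by gcongr)
      _ = _ := by rw [two_mul, Real.exp_add]; ring
  have hlim : Tendsto (fun ε : ℝ => Real.exp (2 * ε) * (J + ε)) (𝓝[>] 0) (𝓝 J) := by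
    have : ContinuousAt (fun ε : ℝ => Real.exp (2 * ε) * (J + ε)) 0 := by fun_prop
    have h := this.tendsto
    simp only [mul_zero, Real.exp_zero, add_zero, one_mul] at h
    exact h.mono_left nhdsWithin_le_nhds
  exact ge_of_tendsto hlim (eventually_mem_nhdsWithin.mono fun ε hε => main ε hε)

/-! ### Hardy space H¹: Poisson representation by boundary values -/

/-- A sequence of radii increasing to `1`. -/
noncomputable def radiusSeq (n : ℕ) : ℝ := 1 - 1 / ((n : ℝ) + 2)

theorem radiusSeq_nonneg (n : ℕ) : 0 ≤ radiusSeq n := by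
  have : 1 / ((n : ℝ) + 2) ≤ 1 := by
    rw [div_le_one (by positivity)]; linarith [n.cast_nonneg (α := ℝ)]
  unfold radiusSeq; linarith

theorem radiusSeq_lt_one (n : ℕ) : radiusSeq n < 1 := by
  have : 0 < 1 / ((n : ℝ) + 2) := by positivity
  unfold radiusSeq; linarith

theorem tendsto_radiusSeq : Tendsto radiusSeq atTop (𝓝 1) := by
  have h : Tendsto (fun n : ℕ => 1 / ((n : ℝ) + 2)) atTop (𝓝 0) := by
    refine tendsto_const_nhds.div_atTop ?_
    exact tendsto_atTop_add_const_right _ _ tendsto_natCast_atTop_atTop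
  have h' := h.const_sub 1
  rwa [sub_zero] at h'

theorem tendsto_radiusSeq_nhdsLT : Tendsto radiusSeq atTop (𝓝[<] 1) :=
  tendsto_nhdsWithin_iff.2 ⟨tendsto_radiusSeq, Eventually.of_forall radiusSeq_lt_one⟩

/-- `g` is the almost everywhere limit of `F` along the circles of radius `radiusSeq n`. -/
def HasSeqBoundaryValues (F : ℂ → ℂ) (g : UnitCircleAngle → ℂ) : Prop :=
  ∀ᵐ t ∂circleMeasure, Tendsto (fun n => F (polarPoint (radiusSeq n) t)) atTop (𝓝 (g t))

theorem HasRadialBoundaryValues.hasSeqBoundaryValues {F : ℂ → ℂ} {u v : UnitCircleAngle → ℝ}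
    (h : HasRadialBoundaryValues F u v) :
    HasSeqBoundaryValues F fun t => (u t : ℂ) + (v t : ℂ) * Complex.I := by
  filter_upwards [h] with t ht using ht.comp tendsto_radiusSeq_nhdsLT

namespace IsHardyOne

variable {F : ℂ → ℂ} {g : UnitCircleAngle → ℂ}

theorem continuous_comp_radiusSeq (hF : IsHardyOne F) (n : ℕ) :
    Continuous fun t => F (polarPoint (radiusSeq n) t) :=
  hF.analytic.continuous_comp_polarPoint (radiusSeq_nonneg n) (radiusSeq_lt_one n)

theorem aestronglyMeasurable_boundary (hF : IsHardyOne F) (hg : HasSeqBoundaryValues F g) :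
    AEStronglyMeasurable g circleMeasure :=
  aestronglyMeasurable_of_tendsto_ae atTop
    (fun n => (hF.continuous_comp_radiusSeq n).aestronglyMeasurable) hg

theorem integrable_boundary (hF : IsHardyOne F) (hg : HasSeqBoundaryValues F g) :
    Integrable g circleMeasure := by
  obtain ⟨M, hM⟩ := hF.bounded_means
  refine ⟨hF.aestronglyMeasurable_boundary hg, lt_of_le_of_lt ?_
    (ENNReal.ofReal_lt_top (r := M))⟩
  have h1 : ∫⁻ t, ‖g t‖ₑ ∂circleMeasure ≤
      ∫⁻ t, liminf (fun n => ‖F (polarPoint (radiusSeq n) t)‖ₑ) atTop ∂circleMeasure := by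
    refine lintegral_mono_ae ?_
    filter_upwards [hg] with t ht using ht.enorm.liminf_eq.ge
  refine h1.trans ((lintegral_liminf_le' fun n =>
    (hF.continuous_comp_radiusSeq n).aestronglyMeasurable.enorm).trans ?_)
  refine (liminf_le_liminf (v := fun _ => ENNReal.ofReal M) (Eventually.of_forall fun n => ?_)).trans
    (by simp)
  change ∫⁻ t, ‖F (polarPoint (radiusSeq n) t)‖ₑ ∂circleMeasure ≤ _
  rw [← ofReal_integral_norm_eq_lintegral_enorm
    (hF.continuous_comp_radiusSeq n).integrable_circleMeasure]
  exact ENNReal.ofReal_le_ofReal (hM _ (radiusSeq_nonneg n) (radiusSeq_lt_one n))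

theorem tendsto_comp_radiusSeq_mul (hF : IsHardyOne F) {w : ℂ} (hw : ‖w‖ < 1) :
    Tendsto (fun n => F (radiusSeq n * w)) atTop (𝓝 (F w)) := by
  have h1 : ContinuousAt F w := (hF.analytic w (by simpa using hw)).continuousAt
  refine h1.tendsto.comp ?_
  have : Tendsto (fun n => (radiusSeq n : ℂ)) atTop (𝓝 1) := by
    exact_mod_cast (Complex.continuous_ofReal.tendsto 1).comp tendsto_radiusSeq
  simpa using this.mul_const w

theorem integrable_circlePoisson_mul {h : UnitCircleAngle → ℝ} (hh : Integrable h circleMeasure)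
    {w : ℂ} (hw : ‖w‖ < 1) : Integrable (fun t => circlePoisson w t * h t) circleMeasure := by
  obtain ⟨C, _, hC⟩ := exists_circlePoisson_le hw
  refine hh.bdd_mul (continuous_circlePoisson hw).aestronglyMeasurable (c := C)
    (Eventually.of_forall fun t => ?_)
  rw [Real.norm_eq_abs, abs_of_nonneg (circlePoisson_nonneg hw t)]
  exact hC t

theorem integrable_sqrt_norm (hg : Integrable g circleMeasure) :
    Integrable (fun t => √‖g t‖) circleMeasure := by
  refine ((integrable_const (1 : ℝ)).add hg.norm).mono
    (Real.continuous_sqrt.comp_aestronglyMeasurable hg.aestronglyMeasurable.norm)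
    (Eventually.of_forall fun t => ?_)
  have h1 := Real.sqrt_nonneg ‖g t‖
  have h2 := Real.mul_self_sqrt (norm_nonneg (g t))
  simp only [Real.norm_eq_abs, Pi.add_apply]
  rw [abs_of_nonneg h1, abs_of_nonneg (by positivity)]
  nlinarith [sq_nonneg (√‖g t‖ - 1)]

/-- The exponent 1/2 supplies uniform integrability. With s = √|F_r|, one has s ≤ s²/K where s ≥ K,
so cutting s at `K` costs at most CM/K uniformly in r. The truncated integrals converge by
domination, and then K → ∞. -/
theorem sqrt_norm_le_integral_boundary (hF : IsHardyOne F) (hg : HasSeqBoundaryValues F g)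
    {w : ℂ} (hw : ‖w‖ < 1) :
    √‖F w‖ ≤ ∫ t, circlePoisson w t * √‖g t‖ ∂circleMeasure := by
  obtain ⟨M, hM⟩ := hF.bounded_means
  obtain ⟨C, hC0, hC⟩ := exists_circlePoisson_le hw
  have hPc := continuous_circlePoisson hw
  have hP0 := circlePoisson_nonneg hw
  have hgi := hF.integrable_boundary hg
  have hsi := integrable_circlePoisson_mul (integrable_sqrt_norm hgi) hw
  have main : ∀ K : ℝ, 0 < K →
      √‖F w‖ ≤ (∫ t, circlePoisson w t * √‖g t‖ ∂circleMeasure) + C * M / K := by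
    intro K hK
    have hmeas : ∀ h : UnitCircleAngle → ℂ, AEStronglyMeasurable h circleMeasure →
        AEStronglyMeasurable (fun t => circlePoisson w t * min √‖h t‖ K) circleMeasure := by
      intro h hh
      refine hPc.aestronglyMeasurable.mul ?_
      exact (Real.continuous_sqrt.comp_aestronglyMeasurable hh.norm).inf
        aestronglyMeasurable_const
    have hbd : ∀ h : UnitCircleAngle → ℂ, ∀ t, ‖circlePoisson w t * min √‖h t‖ K‖ ≤ C * K := by
      intro h t
      have : 0 ≤ min √‖h t‖ K := le_min (Real.sqrt_nonneg _) hK.le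
      rw [Real.norm_eq_abs, abs_of_nonneg (mul_nonneg (hP0 t) this)]
      exact mul_le_mul (hC t) (min_le_right _ _) this hC0.le
    have step : ∀ n, √‖F (radiusSeq n * w)‖ ≤
        (∫ t, circlePoisson w t * min √‖F (polarPoint (radiusSeq n) t)‖ K ∂circleMeasure)
          + C * M / K := by
      intro n
      have hc := hF.continuous_comp_radiusSeq n
      have h1 := (hF.analytic.diffContOnCl_comp_mul (radiusSeq_nonneg n)
        (radiusSeq_lt_one n)).sqrt_norm_le_integral_circlePoisson hw
      simp only [← polarPoint_eq_mul] at h1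
      refine h1.trans ?_
      have hi1 : Integrable (fun t => circlePoisson w t *
          min √‖F (polarPoint (radiusSeq n) t)‖ K) circleMeasure :=
        Continuous.integrable_circleMeasure
          (hPc.mul ((Real.continuous_sqrt.comp hc.norm).min continuous_const))
      have hi2 : Integrable (fun t => C / K * ‖F (polarPoint (radiusSeq n) t)‖) circleMeasure :=
        Continuous.integrable_circleMeasure (continuous_const.mul hc.norm)
      calc _ ≤ ∫ t, (circlePoisson w t * min √‖F (polarPoint (radiusSeq n) t)‖ K
              + C / K * ‖F (polarPoint (radiusSeq n) t)‖) ∂circleMeasure := by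
            refine integral_mono (Continuous.integrable_circleMeasure
              (hPc.mul (Real.continuous_sqrt.comp hc.norm))) (hi1.add hi2) fun t => ?_
            have h2 := Real.sqrt_nonneg ‖F (polarPoint (radiusSeq n) t)‖
            have h3 := Real.mul_self_sqrt (norm_nonneg (F (polarPoint (radiusSeq n) t)))
            set s := √‖F (polarPoint (radiusSeq n) t)‖
            rw [← h3]
            rcases le_total s K with h | h
            · rw [min_eq_left h]
              have : 0 ≤ C / K * (s * s) := by positivity
              simpa using this
            · have h4 : s ≤ s * s / K := by
                rw [le_div_iff₀ hK]; nlinarith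
              have h5 : circlePoisson w t * s ≤ C * (s * s / K) :=
                mul_le_mul (hC t) h4 h2 hC0.le
              have h6 : 0 ≤ circlePoisson w t * min s K :=
                mul_nonneg (hP0 t) (le_min h2 hK.le)
              calc circlePoisson w t * s ≤ C * (s * s / K) := h5
                _ = C / K * (s * s) := by ring
                _ ≤ _ := by linarith
        _ ≤ _ := by
            rw [integral_add hi1 hi2, integral_const_mul, mul_div_right_comm]
            gcongr
            exact hM _ (radiusSeq_nonneg n) (radiusSeq_lt_one n)
    have hl : Tendsto (fun n => √‖F (radiusSeq n * w)‖) atTop (𝓝 √‖F w‖) :=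
      (Real.continuous_sqrt.comp continuous_norm).continuousAt.tendsto.comp
        (hF.tendsto_comp_radiusSeq_mul hw)
    have hr : Tendsto (fun n => ∫ t, circlePoisson w t *
        min √‖F (polarPoint (radiusSeq n) t)‖ K ∂circleMeasure) atTop
        (𝓝 (∫ t, circlePoisson w t * min √‖g t‖ K ∂circleMeasure)) := by
      refine tendsto_integral_of_dominated_convergence (fun _ => C * K)
        (fun n => hmeas _ (hF.continuous_comp_radiusSeq n).aestronglyMeasurable)
        (integrable_const _) (fun n => Eventually.of_forall (hbd _)) ?_
      filter_upwards [hg] with t ht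
      have h1 : Continuous fun z : ℂ => circlePoisson w t * min √‖z‖ K := by fun_prop
      exact (h1.tendsto _).comp ht
    refine (le_of_tendsto_of_tendsto' hl (hr.add_const _) step).trans ?_
    refine add_le_add_left (integral_mono ((integrable_const (C * K)).mono (hmeas _ hgi.aestronglyMeasurable)
      (Eventually.of_forall fun t => (hbd g t).trans (le_abs_self _))) hsi fun t => ?_) _
    exact mul_le_mul_of_nonneg_left (min_le_left _ _) (hP0 t)
  have hlim : Tendsto (fun K : ℝ => (∫ t, circlePoisson w t * √‖g t‖ ∂circleMeasure) + C * M / K)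
      atTop (𝓝 (∫ t, circlePoisson w t * √‖g t‖ ∂circleMeasure)) := by
    simpa using (tendsto_const_nhds (x := C * M)).div_atTop tendsto_id |>.const_add _
  exact ge_of_tendsto hlim ((eventually_gt_atTop 0).mono main)

/-- Jensen's inequality for the square, applied to √|g| and the probability measure with the Poisson
kernel as density. -/
theorem norm_le_integral_boundary (hF : IsHardyOne F) (hg : HasSeqBoundaryValues F g)
    {w : ℂ} (hw : ‖w‖ < 1) :
    ‖F w‖ ≤ ∫ t, circlePoisson w t * ‖g t‖ ∂circleMeasure := by
  have hgi := hF.integrable_boundary hg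
  have h1 := hF.sqrt_norm_le_integral_boundary hg hw
  have hsi := integrable_circlePoisson_mul (integrable_sqrt_norm hgi) hw
  have hPi := (continuous_circlePoisson hw).integrable_circleMeasure
  set a := ∫ t, circlePoisson w t * √‖g t‖ ∂circleMeasure with ha
  have h2 : ‖F w‖ ≤ a ^ 2 := (Real.sqrt_le_iff.1 h1).2
  -- Jensen by the tangent line at the mean: 2as - a² ≤ s².
  have h3 : a ^ 2 = ∫ t, (2 * a * (circlePoisson w t * √‖g t‖) - a ^ 2 * circlePoisson w t)
      ∂circleMeasure := by
    rw [integral_sub (hsi.const_mul _) (hPi.const_mul _), integral_const_mul, integral_const_mul,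
      ← ha, integral_circlePoisson hw]
    ring
  rw [h3] at h2
  refine h2.trans (integral_mono ((hsi.const_mul _).sub (hPi.const_mul _))
    (integrable_circlePoisson_mul hgi.norm hw) fun t => ?_)
  have h4 := circlePoisson_nonneg hw t
  have h5 := Real.mul_self_sqrt (norm_nonneg (g t))
  simp only
  nlinarith [mul_nonneg h4 (sq_nonneg (√‖g t‖ - a))]

theorem integral_norm_le_integral_norm_boundary (hF : IsHardyOne F)
    (hg : HasSeqBoundaryValues F g) {r : ℝ} (h0 : 0 ≤ r) (h1 : r < 1) :
    ∫ t, ‖F (polarPoint r t)‖ ∂circleMeasure ≤ ∫ t, ‖g t‖ ∂circleMeasure := by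
  have hgi := hF.integrable_boundary hg
  have hcont := continuous_circlePoisson_polarPoint h0 h1
  have hr : ∀ s, ‖polarPoint r s‖ < 1 := fun s => by simpa using polarPoint_mem_ball h0 h1 s
  have hi : Integrable (fun x : UnitCircleAngle × UnitCircleAngle =>
      circlePoisson (polarPoint r x.1) x.2 * ‖g x.2‖) (circleMeasure.prod circleMeasure) := by
    obtain ⟨C, hC⟩ := isCompact_univ.bddAbove_image hcont.continuousOn
    refine Integrable.bdd_mul (hgi.norm.comp_snd circleMeasure) hcont.aestronglyMeasurable (c := C)
      (Eventually.of_forall fun x => ?_)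
    rw [Real.norm_eq_abs, abs_of_nonneg (circlePoisson_nonneg (hr _) _)]
    exact hC ⟨x, trivial, rfl⟩
  calc _ ≤ ∫ s, ∫ t, circlePoisson (polarPoint r s) t * ‖g t‖ ∂circleMeasure ∂circleMeasure := by
        refine integral_mono (Continuous.integrable_circleMeasure
          (hF.analytic.continuous_comp_polarPoint h0 h1).norm) hi.integral_prod_left fun s => ?_
        exact hF.norm_le_integral_boundary hg (hr s)
    _ = ∫ t, ∫ s, circlePoisson (polarPoint r s) t * ‖g t‖ ∂circleMeasure ∂circleMeasure :=
        integral_integral_swap hi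
    _ = _ := by
        congr 1 with t
        rw [integral_mul_const]
        simp_rw [circlePoisson_polarPoint_comm r _ t]
        rw [integral_circlePoisson (hr t), one_mul]

/-- The functions `t ↦ F (r e^{it})` converge to the boundary values in `L¹`. -/
theorem tendsto_integral_norm_sub_boundary (hF : IsHardyOne F) (hg : HasSeqBoundaryValues F g) :
    Tendsto (fun n => ∫ t, ‖F (polarPoint (radiusSeq n) t) - g t‖ ∂circleMeasure) atTop (𝓝 0) := by
  have hgi := hF.integrable_boundary hg
  have hFi := fun n => (hF.continuous_comp_radiusSeq n).integrable_circleMeasure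
  -- The Brezis–Lieb device: |F_r| - |F_r - g| is dominated by |g| although |F_r| need not be
  -- dominated. As ∫|F_r| ≤ ∫|g|, the remainder ∫|F_r - g| is squeezed to 0.
  have hd : Tendsto (fun n => ∫ t, (‖F (polarPoint (radiusSeq n) t)‖
      - ‖F (polarPoint (radiusSeq n) t) - g t‖) ∂circleMeasure) atTop
      (𝓝 (∫ t, ‖g t‖ ∂circleMeasure)) := by
    refine tendsto_integral_of_dominated_convergence (fun t => ‖g t‖)
      (fun n => ((hFi n).norm.sub ((hFi n).sub hgi).norm).aestronglyMeasurable) hgi.norm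
      (fun n => Eventually.of_forall fun t => ?_) ?_
    · rw [Real.norm_eq_abs]
      refine (abs_norm_sub_norm_le _ _).trans ?_
      simp
    · filter_upwards [hg] with t ht
      simpa using ht.norm.sub (ht.sub_const (g t)).norm
  have h0 : Tendsto (fun n => (∫ t, ‖g t‖ ∂circleMeasure) -
      ∫ t, (‖F (polarPoint (radiusSeq n) t)‖
      - ‖F (polarPoint (radiusSeq n) t) - g t‖) ∂circleMeasure) atTop (𝓝 0) := by
    simpa using hd.const_sub (∫ t, ‖g t‖ ∂circleMeasure)
  refine squeeze_zero (fun n => integral_nonneg fun t => norm_nonneg _) (fun n => ?_) h0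
  have hs := integral_sub (hFi n).norm ((hFi n).sub hgi).norm
  simp only [Pi.sub_apply] at hs
  rw [hs]
  have := hF.integral_norm_le_integral_norm_boundary hg (radiusSeq_nonneg n) (radiusSeq_lt_one n)
  linarith

/-- A function in `H¹` is the Poisson integral of its boundary values. -/
theorem eq_integral_boundary (hF : IsHardyOne F) (hg : HasSeqBoundaryValues F g)
    {w : ℂ} (hw : ‖w‖ < 1) :
    F w = ∫ t, (circlePoisson w t : ℂ) * g t ∂circleMeasure := by
  obtain ⟨C, hC0, hC⟩ := exists_circlePoisson_le hw
  have hgi := hF.integrable_boundary hg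
  have hFi := fun n => (hF.continuous_comp_radiusSeq n).integrable_circleMeasure
  have hmul : ∀ h : UnitCircleAngle → ℂ, Integrable h circleMeasure →
      Integrable (fun t => (circlePoisson w t : ℂ) * h t) circleMeasure := fun h hh => by
    refine hh.bdd_mul (Complex.continuous_ofReal.comp
      (continuous_circlePoisson hw)).aestronglyMeasurable (c := C)
      (Eventually.of_forall fun t => ?_)
    rw [Complex.norm_real, Real.norm_eq_abs, abs_of_nonneg (circlePoisson_nonneg hw t)]
    exact hC t
  refine tendsto_nhds_unique (hF.tendsto_comp_radiusSeq_mul hw) ?_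
  rw [tendsto_iff_norm_sub_tendsto_zero]
  have h0 := (hF.tendsto_integral_norm_sub_boundary hg).const_mul C
  rw [mul_zero] at h0
  refine squeeze_zero (fun n => norm_nonneg _) (fun n => ?_) h0
  rw [hF.analytic.eq_integral_circlePoisson (radiusSeq_nonneg n) (radiusSeq_lt_one n) hw,
    ← integral_sub (hmul _ (hFi n)) (hmul _ hgi), ← integral_const_mul]
  refine (norm_integral_le_integral_norm _).trans (integral_mono
    ((hmul _ (hFi n)).sub (hmul _ hgi)).norm (((hFi n).sub hgi).norm.const_mul C) fun t => ?_)
  simp only [← mul_sub, norm_mul, Complex.norm_real, Real.norm_eq_abs,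
    abs_of_nonneg (circlePoisson_nonneg hw t)]
  gcongr
  exact hC t

end IsHardyOne

/-! ### Harmonic measure of rays and the bound for |Im g| -/

/-- Harmonic measure, at the point `w` of the right half plane, of the set of all `i s` with
`c < |s|`. -/
noncomputable def rayMeasure (c : ℝ) (w : ℂ) : ℝ :=
  1 + ((w - c * Complex.I).arg - (w + c * Complex.I).arg) / Real.pi

/-- The harmonic function on the right half plane which, pulled back to the half strip by
`z ↦ sinh (π z / 2)`, has boundary values `|Im z| ^ p`. -/
noncomputable def stripPotential (p : ℝ) (w : ℂ) : ℝ :=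
  ∫ t in (0 : ℝ)..1, p * t ^ (p - 1) * rayMeasure (Real.sin (Real.pi * t / 2)) w

theorem arg_eq_arctan_of_re_pos {z : ℂ} (hz : 0 < z.re) : z.arg = Real.arctan (z.im / z.re) := by
  have h := abs_lt.1 (Complex.abs_arg_lt_pi_div_two_iff.2 (Or.inl hz))
  rw [← Complex.tan_arg, Real.arctan_tan h.1 h.2]

theorem abs_arg_add_mul_I_lt {w : ℂ} (hw : 0 < w.re) (c : ℝ) :
    |(w + c * Complex.I).arg| < Real.pi / 2 :=
  Complex.abs_arg_lt_pi_div_two_iff.2 (Or.inl (by simpa using hw))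

theorem abs_arg_sub_mul_I_lt {w : ℂ} (hw : 0 < w.re) (c : ℝ) :
    |(w - c * Complex.I).arg| < Real.pi / 2 :=
  Complex.abs_arg_lt_pi_div_two_iff.2 (Or.inl (by simpa using hw))

theorem rayMeasure_nonneg {w : ℂ} (hw : 0 < w.re) (c : ℝ) : 0 ≤ rayMeasure c w := by
  have h1 := abs_lt.1 (abs_arg_add_mul_I_lt hw c)
  have h2 := abs_lt.1 (abs_arg_sub_mul_I_lt hw c)
  have : -1 ≤ ((w - c * Complex.I).arg - (w + c * Complex.I).arg) / Real.pi := by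
    rw [le_div_iff₀ Real.pi_pos]; linarith
  unfold rayMeasure; linarith

theorem rayMeasure_le_one {w : ℂ} (hw : 0 < w.re) {c : ℝ} (hc : 0 ≤ c) : rayMeasure c w ≤ 1 := by
  have : ((w - c * Complex.I).arg - (w + c * Complex.I).arg) / Real.pi ≤ 0 := by
    refine div_nonpos_of_nonpos_of_nonneg (sub_nonpos.2 ?_) Real.pi_pos.le
    rw [arg_eq_arctan_of_re_pos (by simpa using hw), arg_eq_arctan_of_re_pos (by simpa using hw)]
    refine Real.arctan_strictMono.monotone ?_
    simp only [Complex.sub_im, Complex.add_im, Complex.sub_re, Complex.add_re, Complex.mul_im,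
      Complex.mul_re, Complex.ofReal_re, Complex.ofReal_im, Complex.I_re, Complex.I_im]
    simp only [mul_zero, mul_one, sub_zero, add_zero]
    gcongr
    linarith
  unfold rayMeasure; linarith

/-- The upper and lower rays have harmonic measures 1/2 + arg(w - ic)/π and 1/2 - arg(w + ic)/π.
Their difference stands on the left, their sum on the right, and both are nonnegative. -/
theorem abs_arg_add_arg_le_rayMeasure {w : ℂ} (hw : 0 < w.re) (c : ℝ) :
    |((w + c * Complex.I).arg + (w - c * Complex.I).arg) / Real.pi| ≤ rayMeasure c w := by
  have h1 := abs_lt.1 (abs_arg_add_mul_I_lt hw c)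
  have h2 := abs_lt.1 (abs_arg_sub_mul_I_lt hw c)
  have e : rayMeasure c w = (Real.pi + ((w - c * Complex.I).arg - (w + c * Complex.I).arg))
      / Real.pi := by
    unfold rayMeasure; field_simp
  rw [abs_div, abs_of_pos Real.pi_pos, e]
  gcongr
  rw [abs_le]
  constructor <;> linarith

theorem continuous_arg_add_mul_I {X : Type*} [TopologicalSpace X] {w : X → ℂ} {c : X → ℝ}
    (hw : Continuous w) (hc : Continuous c) (hpos : ∀ x, 0 < (w x).re) :
    Continuous fun x => (w x + c x * Complex.I).arg := by
  refine continuous_iff_continuousAt.2 fun x => ?_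
  have h : w x + c x * Complex.I ∈ Complex.slitPlane := Or.inl (by simpa using hpos x)
  exact ContinuousAt.comp (f := fun x => w x + c x * Complex.I) (Complex.continuousAt_arg h)
    (by fun_prop)

theorem continuous_rayMeasure {X : Type*} [TopologicalSpace X] {w : X → ℂ} {c : X → ℝ}
    (hw : Continuous w) (hc : Continuous c) (hpos : ∀ x, 0 < (w x).re) :
    Continuous fun x => rayMeasure (c x) (w x) := by
  have h1 := continuous_arg_add_mul_I hw hc hpos
  have h2 := continuous_arg_add_mul_I hw hc.neg hpos
  simp only [Pi.neg_apply, Complex.ofReal_neg, neg_mul, ← sub_eq_add_neg] at h2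
  unfold rayMeasure
  fun_prop

theorem integral_comp_sin_zero_two_pi {A : ℝ → ℝ} (hA : Continuous A) :
    ∫ θ in (0 : ℝ)..2 * Real.pi, A (Real.sin θ) = Real.pi * ∫ t in (0 : ℝ)..1,
      (A (Real.sin (Real.pi * t / 2)) + A (-Real.sin (Real.pi * t / 2))) := by
  have hint : ∀ (f : ℝ → ℝ), Continuous f → ∀ a b, IntervalIntegrable f volume a b :=
    fun f hf a b => hf.intervalIntegrable a b
  have hs : Continuous fun θ => A (Real.sin θ) := by fun_prop
  have quarter : ∀ B : ℝ → ℝ, Continuous B → ∫ θ in (0 : ℝ)..Real.pi, B (Real.sin θ)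
      = Real.pi * ∫ t in (0 : ℝ)..1, B (Real.sin (Real.pi * t / 2)) := by
    intro B hB
    have hBs : Continuous fun θ => B (Real.sin θ) := by fun_prop
    have e1 : ∫ θ in (Real.pi / 2)..Real.pi, B (Real.sin θ)
        = ∫ θ in (0 : ℝ)..(Real.pi / 2), B (Real.sin θ) := by
      have := intervalIntegral.integral_comp_sub_left (a := 0) (b := Real.pi / 2)
        (fun θ => B (Real.sin θ)) Real.pi
      simp only [Real.sin_pi_sub, sub_zero, sub_half] at this
      exact this.symm
    have e2 : ∫ t in (0 : ℝ)..1, B (Real.sin (Real.pi * t / 2))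
        = (Real.pi / 2)⁻¹ * ∫ θ in (0 : ℝ)..(Real.pi / 2), B (Real.sin θ) := by
      have := intervalIntegral.integral_comp_mul_left (a := 0) (b := 1)
        (fun θ => B (Real.sin θ)) (c := Real.pi / 2) (by positivity)
      simp only [mul_zero, mul_one, smul_eq_mul] at this
      rw [← this]
      congr 1 with t
      ring_nf
    rw [← intervalIntegral.integral_add_adjacent_intervals (hint _ hBs 0 (Real.pi / 2))
      (hint _ hBs _ _), e1, e2]
    field_simp
    ring
  have e3 : ∫ θ in Real.pi..(2 * Real.pi), A (Real.sin θ)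
      = ∫ θ in (0 : ℝ)..Real.pi, A (-Real.sin θ) := by
    have := intervalIntegral.integral_comp_add_right (a := 0) (b := Real.pi)
      (fun θ => A (Real.sin θ)) Real.pi
    simp only [Real.sin_add_pi, zero_add, ← two_mul] at this
    exact this.symm
  rw [← intervalIntegral.integral_add_adjacent_intervals (hint _ hs 0 Real.pi) (hint _ hs _ _),
    e3, quarter A hA, quarter (fun x => A (-x)) (by fun_prop), ← mul_add,
    intervalIntegral.integral_add (hint _ (by fun_prop) _ _) (hint _ (by fun_prop) _ _)]

/-- Mean value property of log(1 + qz), which vanishes at 0. -/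
theorem circleAverage_arg_one_add_mul {q : ℂ} (hq : ‖q‖ < 1) :
    Real.circleAverage (fun ξ => (1 + q * ξ).arg) 0 1 = 0 := by
  have hslit : ∀ z ∈ closure (Metric.ball (0 : ℂ) 1), 1 + q * z ∈ Complex.slitPlane := by
    intro z hz
    have hz' : ‖z‖ ≤ 1 := by simpa using Metric.closure_ball_subset_closedBall hz
    refine Complex.mem_slitPlane_of_norm_lt_one ?_
    rw [norm_mul]
    nlinarith [norm_nonneg z, norm_nonneg q]
  have hd : DiffContOnCl ℂ (fun z => Complex.log (1 + q * z)) (Metric.ball 0 1) := by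
    apply DifferentiableOn.diffContOnCl
    exact DifferentiableOn.clog (by fun_prop) hslit
  have h := hd.eq_integral_circlePoisson (w := 0) (by simp)
  simp only [circlePoisson_zero, Complex.ofReal_one, one_mul, mul_zero, add_zero,
    Complex.log_one] at h
  rw [← integral_circleMeasure_eq_circleAverage]
  have hc : Continuous fun t => Complex.log (1 + q * polarPoint 1 t) := by
    refine Continuous.clog (by fun_prop) fun t => hslit _ ?_
    rw [closure_ball _ one_ne_zero]
    simp [norm_polarPoint]
  have := integral_im hc.integrable_circleMeasure
  rw [← h] at this
  simpa [Complex.log_im] using this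

theorem Complex.sinh_re_eq_mul (ζ : ℂ) :
    (Complex.sinh ζ).re = Real.sinh ζ.re * Real.cos ζ.im := by
  conv_lhs => rw [← Complex.re_add_im ζ]
  rw [Complex.sinh_add, Complex.sinh_mul_I, Complex.cosh_mul_I]
  simp [← Complex.ofReal_sinh, ← Complex.ofReal_cosh, ← Complex.ofReal_sin, ← Complex.ofReal_cos]

theorem Complex.sinh_im_eq_mul (ζ : ℂ) :
    (Complex.sinh ζ).im = Real.cosh ζ.re * Real.sin ζ.im := by
  conv_lhs => rw [← Complex.re_add_im ζ]
  rw [Complex.sinh_add, Complex.sinh_mul_I, Complex.cosh_mul_I]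
  simp [← Complex.ofReal_sinh, ← Complex.ofReal_cosh, ← Complex.ofReal_sin, ← Complex.ofReal_cos]

theorem Complex.sinh_re_pos {ζ : ℂ} (h0 : 0 < ζ.re) (h1 : |ζ.im| < Real.pi / 2) :
    0 < (Complex.sinh ζ).re := by
  rw [Complex.sinh_re_eq_mul]
  exact mul_pos (Real.sinh_pos_iff.2 h0) (Real.cos_pos_of_mem_Ioo (abs_lt.1 h1))

/-- With q = e^{-ζ}, sinh ζ + i sin θ = (e^ζ/2)(1 + q e^{iθ})(1 - q e^{-iθ}). The last two factors
are of the form whose argument has circle average 0, so only Im ζ will survive averaging. -/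
theorem arg_sinh_add_sin {ζ : ℂ} (h0 : 0 < ζ.re) (h1 : |ζ.im| < Real.pi / 2) (θ : ℝ) :
    (Complex.sinh ζ + Real.sin θ * Complex.I).arg
      = ζ.im + (1 + Complex.exp (-ζ) * circleMap 0 1 θ).arg
        + (1 + -Complex.exp (-ζ) * (circleMap 0 1 θ)⁻¹).arg := by
  set q := Complex.exp (-ζ) with hq
  have hqn : ‖q‖ < 1 := by
    rw [hq, Complex.norm_exp]; simpa using h0
  have hre := Complex.sinh_re_pos h0 h1
  have hre1 : 0 < (Complex.sinh ζ + Real.sin θ * Complex.I).re := by simpa using hre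
  have hone : ∀ z : ℂ, ‖z‖ < 1 → 0 < (1 + z).re := fun z hz => by
    have := (abs_lt.1 ((Complex.abs_re_le_norm z).trans_lt hz)).1
    simp only [Complex.add_re, Complex.one_re]; linarith
  have hre2 : 0 < (1 + q * circleMap 0 1 θ).re := hone _ (by simpa using hqn)
  have hre3 : 0 < (1 + -q * (circleMap 0 1 θ)⁻¹).re := hone _ (by simpa using hqn)
  have hne : ∀ z : ℂ, 0 < z.re → z ≠ 0 := fun z hz h => by simp [h] at hz
  have hexp : Complex.exp (Complex.log (Complex.sinh ζ + Real.sin θ * Complex.I))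
      = Complex.exp (ζ - Real.log 2 + Complex.log (1 + q * circleMap 0 1 θ)
        + Complex.log (1 + -q * (circleMap 0 1 θ)⁻¹)) := by
    rw [Complex.exp_log (hne _ hre1), Complex.exp_add, Complex.exp_add, Complex.exp_sub,
      Complex.exp_log (hne _ hre2), Complex.exp_log (hne _ hre3), ← Complex.ofReal_exp,
      Real.exp_log two_pos, Complex.ofReal_ofNat, Complex.ofReal_sin, Complex.sin, Complex.sinh]
    have e1 : circleMap 0 1 θ = Complex.exp (θ * Complex.I) := by simp [circleMap]
    have e2 : Complex.exp (-θ * Complex.I) = (Complex.exp (θ * Complex.I))⁻¹ := by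
      rw [neg_mul, Complex.exp_neg]
    have e3 : q = (Complex.exp ζ)⁻¹ := by rw [hq, Complex.exp_neg]
    rw [e1, e2, ← hq, e3]
    have n1 := Complex.exp_ne_zero ζ
    have n2 := Complex.exp_ne_zero (θ * Complex.I)
    generalize Complex.exp ζ = a at *
    generalize Complex.exp (θ * Complex.I) = b at *
    field_simp
    linear_combination (a - a * b ^ 2) * Complex.I_sq
  obtain ⟨n, hn⟩ := Complex.exp_eq_exp_iff_exists_int.1 hexp
  have him := congrArg Complex.im hn
  simp only [Complex.add_im, Complex.sub_im, Complex.log_im, Complex.ofReal_im, Complex.mul_im,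
    Complex.mul_re, Complex.intCast_re, Complex.intCast_im, Complex.I_im, Complex.I_re,
    Complex.ofReal_re, Complex.re_ofNat, Complex.im_ofNat] at him
  have b1 := abs_lt.1 (Complex.abs_arg_lt_pi_div_two_iff.2 (Or.inl hre1))
  have b2 := abs_lt.1 (Complex.abs_arg_lt_pi_div_two_iff.2 (Or.inl hre2))
  have b3 := abs_lt.1 (Complex.abs_arg_lt_pi_div_two_iff.2 (Or.inl hre3))
  have b4 := abs_lt.1 h1
  have hpi := Real.pi_pos
  -- Four angles, each below π/2 in modulus, cannot combine to a nonzero multiple of 2π.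
  have hn0 : n = 0 := by
    have l1 : (n : ℝ) < 1 := by nlinarith
    have l2 : (-1 : ℝ) < n := by nlinarith
    have l1' : n < 1 := by exact_mod_cast l1
    have l2' : -1 < n := by exact_mod_cast l2
    omega
  rw [hn0] at him
  simp only [Int.cast_zero] at him
  linarith

/-- The mean value of `arg (sinh ζ + i sin θ)` over a period is `Im ζ`. -/
theorem integral_arg_sinh_add_sin {ζ : ℂ} (h0 : 0 < ζ.re) (h1 : |ζ.im| < Real.pi / 2) :
    ∫ θ in (0 : ℝ)..2 * Real.pi, (Complex.sinh ζ + Real.sin θ * Complex.I).arg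
      = 2 * Real.pi * ζ.im := by
  set q := Complex.exp (-ζ) with hq
  have hqn : ‖q‖ < 1 := by
    rw [hq, Complex.norm_exp]; simpa using h0
  have hc : ∀ q : ℂ, ‖q‖ < 1 → ContinuousOn (fun ξ => (1 + q * ξ).arg) (Metric.sphere 0 |1|) := by
    intro q hq ξ hξ
    have h2 : 1 + q * ξ ∈ Complex.slitPlane := by
      refine Complex.mem_slitPlane_of_norm_lt_one ?_
      have : ‖ξ‖ = 1 := by simpa using hξ
      rwa [norm_mul, this, mul_one]
    exact (ContinuousAt.comp (f := fun ξ : ℂ => 1 + q * ξ) (Complex.continuousAt_arg h2)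
      (by fun_prop)).continuousWithinAt
  have i1 : CircleIntegrable (fun ξ => (1 + q * ξ).arg) 0 1 := (hc q hqn).circleIntegrable'
  have i2 : CircleIntegrable (fun ξ => (1 + -q * ξ⁻¹).arg) 0 1 := by
    refine ContinuousOn.circleIntegrable' ?_
    refine (hc (-q) (by simpa using hqn)).comp (f := fun ξ : ℂ => ξ⁻¹) ?_ ?_
    · refine continuousOn_inv₀.mono fun ξ hξ h => ?_
      rw [h] at hξ; simp at hξ
    · intro ξ hξ; simpa using hξ
  have key : Real.circleAverage (fun ξ => ζ.im + (1 + q * ξ).arg + (1 + -q * ξ⁻¹).arg) 0 1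
      = ζ.im := by
    have i3 : CircleIntegrable (fun ξ => ζ.im + (1 + q * ξ).arg) 0 1 :=
      (circleIntegrable_const _ _ _).add i1
    rw [Real.circleAverage_fun_add i3 i2,
      Real.circleAverage_fun_add (circleIntegrable_const _ _ _) i1, Real.circleAverage_const,
      circleAverage_arg_one_add_mul hqn,
      Real.circleAverage_zero_one_congr_inv (f := fun ξ => (1 + -q * ξ).arg),
      circleAverage_arg_one_add_mul (by simpa using hqn)]
    ring
  simp_rw [arg_sinh_add_sin h0 h1, ← hq]
  rwa [Real.circleAverage_def, smul_eq_mul,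
    inv_mul_eq_iff_eq_mul₀ (mul_ne_zero two_ne_zero Real.pi_ne_zero)] at key

/-- Folding the period of θ onto [0, π/2] writes Im g as the integral over t of the
upper-minus-lower ray measures at height sin(πt/2); each difference is at most the corresponding
sum. -/
theorem abs_le_integral_rayMeasure {g : ℂ} (h0 : 0 < g.re) (h1 : |g.im| < 1) :
    |g.im| ≤ ∫ t in (0 : ℝ)..1,
      rayMeasure (Real.sin (Real.pi * t / 2)) (Complex.sinh (Real.pi * g / 2)) := by
  have hpi := Real.pi_pos
  have hre : (Real.pi * g / 2 : ℂ).re = Real.pi * g.re / 2 := by simp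
  have him : (Real.pi * g / 2 : ℂ).im = Real.pi * g.im / 2 := by simp
  have h0' : 0 < (Real.pi * g / 2 : ℂ).re := by rw [hre]; positivity
  have h1' : |(Real.pi * g / 2 : ℂ).im| < Real.pi / 2 := by
    rw [him, abs_div, abs_mul, abs_of_pos hpi, abs_two]
    gcongr
    nlinarith
  have hw := Complex.sinh_re_pos h0' h1'
  set w := Complex.sinh (Real.pi * g / 2) with hwdef
  have hA : Continuous fun c : ℝ => (w + c * Complex.I).arg :=
    continuous_arg_add_mul_I continuous_const continuous_id fun _ => hw
  have hA' : Continuous fun c : ℝ => (w - c * Complex.I).arg := by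
    have := hA.comp continuous_neg
    simpa [Function.comp_def, ← sub_eq_add_neg] using this
  have h2 := integral_comp_sin_zero_two_pi hA
  rw [integral_arg_sinh_add_sin h0' h1', him] at h2
  have h3 : g.im = ∫ t in (0 : ℝ)..1, ((w + Real.sin (Real.pi * t / 2) * Complex.I).arg
      + (w - Real.sin (Real.pi * t / 2) * Complex.I).arg) / Real.pi := by
    rw [intervalIntegral.integral_div]
    simp only [Complex.ofReal_neg, neg_mul, ← sub_eq_add_neg] at h2
    rw [eq_div_iff hpi.ne', ← mul_right_inj' hpi.ne', ← h2]
    ring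
  have hcs : Continuous fun t : ℝ => Real.sin (Real.pi * t / 2) := by fun_prop
  have i1 : Continuous fun t : ℝ => ((w + Real.sin (Real.pi * t / 2) * Complex.I).arg
      + (w - Real.sin (Real.pi * t / 2) * Complex.I).arg) / Real.pi :=
    ((hA.comp hcs).add (hA'.comp hcs)).div_const _
  have i2 : Continuous fun t : ℝ => rayMeasure (Real.sin (Real.pi * t / 2)) w :=
    continuous_rayMeasure continuous_const hcs fun _ => hw
  calc |g.im| ≤ ∫ t in (0 : ℝ)..1, |((w + Real.sin (Real.pi * t / 2) * Complex.I).arg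
      + (w - Real.sin (Real.pi * t / 2) * Complex.I).arg) / Real.pi| := by
        conv_lhs => rw [h3]
        exact intervalIntegral.abs_integral_le_integral_abs zero_le_one
    _ ≤ _ := intervalIntegral.integral_mono_on zero_le_one (i1.abs.intervalIntegrable _ _)
        (i2.intervalIntegrable _ _) fun t _ => abs_arg_add_arg_le_rayMeasure hw _

/-! ### The majorant of |Im g|^p -/

theorem continuous_rpow_weight {p : ℝ} (hp : 1 < p) : Continuous fun t : ℝ => p * t ^ (p - 1) :=
  continuous_const.mul (Real.continuous_rpow_const (by linarith))

theorem integral_rpow_weight {p : ℝ} (hp : 1 < p) (y : ℝ) :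
    ∫ t in (0 : ℝ)..y, p * t ^ (p - 1) = y ^ p := by
  rw [intervalIntegral.integral_const_mul, integral_rpow (Or.inl (by linarith)), sub_add_cancel,
    Real.zero_rpow (by linarith), sub_zero]
  field_simp

/-- Bathtub principle: an increasing weight k is integrated least when the mass y sits in [0, y] at
full density. Comparing k with k(y) on either side of y gives ∫kφ ≥ y^p + k(y)(∫φ - y). -/
theorem rpow_le_integral_rpow_weight_mul {p : ℝ} (hp : 1 < p) {φ : ℝ → ℝ} (hφ : Continuous φ)
    (h0 : ∀ t ∈ Set.Icc (0 : ℝ) 1, 0 ≤ φ t) (h1 : ∀ t ∈ Set.Icc (0 : ℝ) 1, φ t ≤ 1) {y : ℝ}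
    (hy0 : 0 ≤ y) (hy1 : y ≤ 1) (hy : y ≤ ∫ t in (0 : ℝ)..1, φ t) :
    y ^ p ≤ ∫ t in (0 : ℝ)..1, p * t ^ (p - 1) * φ t := by
  have hk := continuous_rpow_weight hp
  set k : ℝ → ℝ := fun t => p * t ^ (p - 1) with hkdef
  have hint : ∀ (f : ℝ → ℝ), Continuous f → ∀ a b, IntervalIntegrable f volume a b :=
    fun f hf a b => hf.intervalIntegrable a b
  have hmono : ∀ s t, 0 ≤ s → s ≤ t → k s ≤ k t := fun s t hs hst => by
    simp only [hkdef]
    have := Real.rpow_le_rpow hs hst (by linarith : 0 ≤ p - 1)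
    gcongr
  have hky : 0 ≤ k y := by simp only [hkdef]; positivity
  have s1 : ∫ t in (0 : ℝ)..y, (k t - k y + k y * φ t) ≤ ∫ t in (0 : ℝ)..y, k t * φ t := by
    refine intervalIntegral.integral_mono_on hy0 (hint _ (by fun_prop) _ _)
      (hint _ (by fun_prop) _ _) fun t ht => ?_
    have := hmono t y ht.1 ht.2
    have := h1 t ⟨ht.1, ht.2.trans hy1⟩
    nlinarith
  have s2 : ∫ t in y..1, k y * φ t ≤ ∫ t in y..1, k t * φ t := by
    refine intervalIntegral.integral_mono_on hy1 (hint _ (by fun_prop) _ _)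
      (hint _ (by fun_prop) _ _) fun t ht => ?_
    have := hmono y t hy0 ht.1
    have := h0 t ⟨hy0.trans ht.1, ht.2⟩
    nlinarith
  rw [intervalIntegral.integral_add (hint _ (by fun_prop) _ _) (hint _ (by fun_prop) _ _),
    intervalIntegral.integral_sub (hint _ hk _ _) (hint _ (by fun_prop) _ _),
    integral_rpow_weight hp y, intervalIntegral.integral_const,
    intervalIntegral.integral_const_mul, smul_eq_mul, sub_zero] at s1
  rw [intervalIntegral.integral_const_mul] at s2
  rw [← intervalIntegral.integral_add_adjacent_intervals (hint _ hφ 0 y) (hint _ hφ y 1)] at hy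
  rw [← intervalIntegral.integral_add_adjacent_intervals
    (hint (fun t => k t * φ t) (by fun_prop) 0 y) (hint _ (by fun_prop) y 1)]
  nlinarith

theorem le_sin_pi_mul_div_two {t : ℝ} (ht : t ∈ Set.Icc (0 : ℝ) 1) : t ≤ Real.sin (Real.pi * t / 2) := by
  have hpi := Real.pi_pos
  have := Real.mul_le_sin (x := Real.pi * t / 2) (by have := ht.1; positivity)
    (by nlinarith [ht.2])
  calc t = 2 / Real.pi * (Real.pi * t / 2) := by field_simp
    _ ≤ _ := this

theorem sinh_half_strip_re_pos {g : ℂ} (h0 : 0 < g.re) (h1 : |g.im| < 1) :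
    0 < (Complex.sinh (Real.pi * g / 2)).re := by
  have hpi := Real.pi_pos
  apply Complex.sinh_re_pos
  · have : (Real.pi * g / 2 : ℂ).re = Real.pi * g.re / 2 := by simp
    rw [this]; positivity
  · have him : (Real.pi * g / 2 : ℂ).im = Real.pi * g.im / 2 := by simp
    rw [him, abs_div, abs_mul, abs_of_pos hpi, abs_two]
    gcongr
    nlinarith

theorem abs_im_rpow_le_stripPotential {p : ℝ} (hp : 1 < p) {g : ℂ} (h0 : 0 < g.re)
    (h1 : |g.im| < 1) : |g.im| ^ p ≤ stripPotential p (Complex.sinh (Real.pi * g / 2)) := by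
  have hw := sinh_half_strip_re_pos h0 h1
  refine rpow_le_integral_rpow_weight_mul hp ?_ (fun t _ => rayMeasure_nonneg hw _)
    (fun t ht => rayMeasure_le_one hw (ht.1.trans (le_sin_pi_mul_div_two ht))) (abs_nonneg _) h1.le
    (abs_le_integral_rayMeasure h0 h1)
  exact continuous_rayMeasure continuous_const (by fun_prop) fun _ => hw

/-! ### Mean values over circles -/

theorem circleMean_eq_of_analyticOnNhd {F : ℂ → ℂ} (hF : AnalyticOnNhd ℂ F (Metric.ball 0 1))
    {r : ℝ} (h0 : 0 ≤ r) (h1 : r < 1) : ∫ t, F (polarPoint r t) ∂circleMeasure = F 0 := by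
  have := hF.eq_integral_circlePoisson h0 h1 (w := 0) (by simp)
  simpa [circlePoisson_zero] using this.symm

/-- Both arguments are imaginary parts of the analytic functions log(W ± ic), since W ± ic stays in
the right half plane. -/
theorem circleMean_rayMeasure {W : ℂ → ℂ} (hW : AnalyticOnNhd ℂ W (Metric.ball 0 1))
    (hpos : ∀ z ∈ Metric.ball (0 : ℂ) 1, 0 < (W z).re) (c : ℝ) {r : ℝ} (h0 : 0 ≤ r) (h1 : r < 1) :
    ∫ s, rayMeasure c (W (polarPoint r s)) ∂circleMeasure = rayMeasure c (W 0) := by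
  have hslit : ∀ (a : ℝ), ∀ z ∈ Metric.ball (0 : ℂ) 1, W z + a * Complex.I ∈ Complex.slitPlane :=
    fun a z hz => Or.inl (by simpa using hpos z hz)
  have harg : ∀ a : ℝ, Integrable (fun s => (W (polarPoint r s) + a * Complex.I).arg) circleMeasure ∧
      ∫ s, (W (polarPoint r s) + a * Complex.I).arg ∂circleMeasure
        = (W 0 + a * Complex.I).arg := by
    intro a
    have hL : AnalyticOnNhd ℂ (fun z => Complex.log (W z + a * Complex.I)) (Metric.ball 0 1) :=
      (hW.add analyticOnNhd_const).clog (hslit a)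
    have hi := (hL.continuous_comp_polarPoint h0 h1).integrable_circleMeasure
    have e1 := integral_im hi
    rw [circleMean_eq_of_analyticOnNhd hL h0 h1] at e1
    have e2 := hi.im
    simp only [RCLike.im_to_complex, Complex.log_im] at e1 e2
    exact ⟨e2, e1⟩
  have hp := harg c
  have hm := harg (-c)
  simp only [Complex.ofReal_neg, neg_mul, ← sub_eq_add_neg] at hm
  have hs := integral_sub hm.1 hp.1
  have hi : Integrable (fun s => ((W (polarPoint r s) - c * Complex.I).arg
      - (W (polarPoint r s) + c * Complex.I).arg) / Real.pi) circleMeasure :=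
    (hm.1.sub hp.1).div_const _
  unfold rayMeasure
  rw [integral_add (integrable_const _) hi, integral_div, hs, hm.2, hp.2]
  simp

/-- Mean value property of `stripPotential p` along analytic functions into the half plane. -/
theorem circleMean_stripPotential {p : ℝ} (hp : 1 < p) {W : ℂ → ℂ}
    (hW : AnalyticOnNhd ℂ W (Metric.ball 0 1))
    (hpos : ∀ z ∈ Metric.ball (0 : ℂ) 1, 0 < (W z).re) {r : ℝ} (h0 : 0 ≤ r) (h1 : r < 1) :
    Integrable (fun s => stripPotential p (W (polarPoint r s))) circleMeasure ∧
    ∫ s, stripPotential p (W (polarPoint r s)) ∂circleMeasure = stripPotential p (W 0) := by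
  have hWc := hW.continuous_comp_polarPoint h0 h1
  have hWpos : ∀ s, 0 < (W (polarPoint r s)).re := fun s => hpos _ (polarPoint_mem_ball h0 h1 s)
  have hc : Continuous fun x : UnitCircleAngle × ℝ => p * x.2 ^ (p - 1) *
      rayMeasure (Real.sin (Real.pi * x.2 / 2)) (W (polarPoint r x.1)) :=
    ((continuous_rpow_weight hp).comp continuous_snd).mul
      (continuous_rayMeasure (hWc.comp continuous_fst) (by fun_prop) fun x => hWpos x.1)
  have hi : Integrable (fun x : UnitCircleAngle × ℝ => p * x.2 ^ (p - 1) *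
      rayMeasure (Real.sin (Real.pi * x.2 / 2)) (W (polarPoint r x.1)))
      (circleMeasure.prod (volume.restrict (Set.Ioc 0 1))) := by
    refine (integrable_const p).mono' hc.aestronglyMeasurable ?_
    have : ∀ᵐ x ∂circleMeasure.prod (volume.restrict (Set.Ioc (0 : ℝ) 1)), x.2 ∈ Set.Ioc (0 : ℝ) 1 :=
      Measure.quasiMeasurePreserving_snd.ae (ae_restrict_mem measurableSet_Ioc)
    filter_upwards [this] with x hx
    have e1 := rayMeasure_nonneg (hWpos x.1) (Real.sin (Real.pi * x.2 / 2))
    have e2 := rayMeasure_le_one (hWpos x.1)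
      (hx.1.le.trans (le_sin_pi_mul_div_two ⟨hx.1.le, hx.2⟩))
    have e3 : x.2 ^ (p - 1) ≤ 1 := Real.rpow_le_one hx.1.le hx.2 (by linarith)
    have e4 : 0 ≤ x.2 ^ (p - 1) := Real.rpow_nonneg hx.1.le _
    rw [Real.norm_eq_abs, abs_of_nonneg (by positivity)]
    calc _ ≤ p * 1 * 1 := by gcongr
      _ = p := by ring
  simp only [stripPotential, intervalIntegral.integral_of_le zero_le_one]
  refine ⟨hi.integral_prod_left, ?_⟩
  rw [integral_integral_swap hi]
  congr 1 with t
  rw [integral_const_mul, circleMean_rayMeasure hW hpos _ h0 h1]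

/-! ### The constant A_p and the potential on the real axis -/

/-- Jordan's inequality sin(πt/2) ≥ t dominates the integrand by t^(p-2), integrable at 0 because p
> 1. -/
theorem intervalIntegrable_sharpConst {p : ℝ} (hp : 1 < p) :
    IntervalIntegrable (fun t : ℝ => t ^ (p - 1) / Real.sin (Real.pi * t / 2)) volume 0 1 := by
  have h : IntervalIntegrable (fun t : ℝ => t ^ (p - 2)) volume 0 1 :=
    intervalIntegral.intervalIntegrable_rpow' (by linarith)
  refine h.mono_fun' (Measurable.aestronglyMeasurable (by fun_prop)) ?_
  refine (ae_restrict_mem measurableSet_uIoc).mono fun t ht => ?_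
  rw [Set.uIoc_of_le zero_le_one] at ht
  have hs := le_sin_pi_mul_div_two ⟨ht.1.le, ht.2⟩
  have e4 : 0 ≤ t ^ (p - 1) := Real.rpow_nonneg ht.1.le _
  simp only [Real.norm_eq_abs]
  rw [abs_of_nonneg (div_nonneg e4 (ht.1.le.trans hs))]
  have e5 : t ^ (p - 2) = t ^ (p - 1) / t := by
    rw [show p - 2 = p - 1 - 1 by ring, Real.rpow_sub_one ht.1.ne']
  rw [e5]
  exact div_le_div_of_nonneg_left e4 ht.1 hs

theorem rayMeasure_ofReal {c x : ℝ} (hc : 0 < c) (hx : 0 < x) :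
    rayMeasure c x = 2 / Real.pi * Real.arctan (x / c) := by
  have h := Real.arctan_inv_of_pos (div_pos hc hx)
  rw [inv_div] at h
  rw [h, rayMeasure, arg_eq_arctan_of_re_pos (by simpa using hx),
    arg_eq_arctan_of_re_pos (by simpa using hx)]
  have hpi := Real.pi_ne_zero
  simp [neg_div]
  field_simp
  ring

/-- The difference a/c - arctan(sinh a / c) is increasing in a: its derivative is nonnegative
exactly when c²(cosh a - 1) ≤ cosh² a - 1, true for c ≤ 1. -/
theorem Real.arctan_sinh_div_le {a c : ℝ} (hc0 : 0 < c) (hc1 : c ≤ 1) (ha : 0 ≤ a) :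
    Real.arctan (Real.sinh a / c) ≤ a / c := by
  let f : ℝ → ℝ := fun x => x / c - Real.arctan (Real.sinh x / c)
  have hd : ∀ x, HasDerivAt f (1 / c - 1 / (1 + (Real.sinh x / c) ^ 2) * (Real.cosh x / c)) x :=
    fun x => ((hasDerivAt_id x).div_const c).sub ((Real.hasDerivAt_sinh x).div_const c).arctan
  have hmono : Monotone f := by
    refine monotone_of_deriv_nonneg (fun x => (hd x).differentiableAt) fun x => ?_
    rw [(hd x).deriv, sub_nonneg, one_div_mul_eq_div, div_div, div_le_div_iff₀ (by positivity) hc0]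
    have h1 := Real.one_le_cosh x
    have h2 := Real.cosh_sq x
    have h3 : c * (1 + (Real.sinh x / c) ^ 2) * c = c ^ 2 + Real.sinh x ^ 2 := by field_simp
    have h4 : c ^ 2 * (Real.cosh x - 1) ≤ Real.cosh x ^ 2 - 1 := by
      nlinarith [mul_nonneg (sub_nonneg.2 h1) (sub_nonneg.2 (by nlinarith : c ^ 2 ≤ 1)),
        mul_nonneg (sub_nonneg.2 h1) (sub_nonneg.2 h1)]
    have h5 : Real.cosh x * c ≤ 1 * ((1 + (Real.sinh x / c) ^ 2) * c) := by
      refine le_of_mul_le_mul_left ?_ hc0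
      calc _ = c ^ 2 * Real.cosh x := by ring
        _ ≤ c ^ 2 + Real.sinh x ^ 2 := by linarith
        _ = _ := by rw [← h3]; ring
    linarith
  have := hmono ha
  simp only [f, zero_div, Real.sinh_zero, Real.arctan_zero, sub_zero] at this
  linarith

theorem stripPotential_sinh_le {p : ℝ} (hp : 1 < p) {x : ℝ} (hx : 0 < x) :
    stripPotential p (Real.sinh (Real.pi * x / 2)) ≤ sharpConst p * x := by
  have hpi := Real.pi_pos
  have hs : 0 < Real.sinh (Real.pi * x / 2) := Real.sinh_pos_iff.2 (by positivity)
  rw [sharpConst, mul_assoc, ← intervalIntegral.integral_mul_const,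
    ← intervalIntegral.integral_const_mul, stripPotential]
  have hsin : Continuous fun t : ℝ => Real.sin (Real.pi * t / 2) := by fun_prop
  refine intervalIntegral.integral_mono_on_of_le_Ioo zero_le_one ?_
    (((intervalIntegrable_sharpConst hp).mul_const x).const_mul p) fun t ht => ?_
  · exact ((continuous_rpow_weight hp).mul (continuous_rayMeasure continuous_const hsin
      fun _ => by rwa [Complex.ofReal_re])).intervalIntegrable _ _
  · have hc := ht.1.trans_le (le_sin_pi_mul_div_two ⟨ht.1.le, ht.2.le⟩)
    have hc1 := Real.sin_le_one (Real.pi * t / 2)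
    set c := Real.sin (Real.pi * t / 2)
    have e4 : 0 ≤ t ^ (p - 1) := Real.rpow_nonneg ht.1.le _
    rw [rayMeasure_ofReal hc hs]
    calc _ ≤ p * t ^ (p - 1) * (2 / Real.pi * (Real.pi * x / 2 / c)) := by
          gcongr
          exact Real.arctan_sinh_div_le hc hc1 (by positivity)
      _ = _ := by field_simp

/-! ### The inequality in the disk and its passage to the boundary -/

/-- The inequality on circles of radius `r < 1`, for functions with values in the open half strip
of half-width `1`. -/
theorem integral_abs_im_rpow_le {p : ℝ} (hp : 1 < p) {G : ℂ → ℂ}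
    (hG : AnalyticOnNhd ℂ G (Metric.ball 0 1))
    (hre : ∀ z ∈ Metric.ball (0 : ℂ) 1, 0 < (G z).re)
    (him : ∀ z ∈ Metric.ball (0 : ℂ) 1, |(G z).im| < 1) (hG0 : (G 0).im = 0)
    {r : ℝ} (h0 : 0 ≤ r) (h1 : r < 1) :
    ∫ t, |(G (polarPoint r t)).im| ^ p ∂circleMeasure ≤ sharpConst p * (G 0).re := by
  have hW : AnalyticOnNhd ℂ (fun z => Complex.sinh (Real.pi * G z / 2)) (Metric.ball 0 1) := by
    intro z hz
    have h1 : AnalyticAt ℂ (fun z => (Real.pi * G z / 2 : ℂ)) z := by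
      have := hG z hz
      fun_prop
    have h2 : AnalyticAt ℂ Complex.sinh (Real.pi * G z / 2) :=
      Complex.differentiable_sinh.analyticAt _
    exact AnalyticAt.fun_comp (f := fun z => (Real.pi * G z / 2 : ℂ)) h2 h1
  obtain ⟨hi, he⟩ := circleMean_stripPotential hp hW
    (fun z hz => sinh_half_strip_re_pos (hre z hz) (him z hz)) h0 h1
  have hGc := hG.continuous_comp_polarPoint h0 h1
  have hm := polarPoint_mem_ball h0 h1
  have h00 : (0 : ℂ) ∈ Metric.ball (0 : ℂ) 1 := by simp
  calc _ ≤ ∫ t, stripPotential p (Complex.sinh (Real.pi * G (polarPoint r t) / 2)) ∂circleMeasure :=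
        integral_mono (Continuous.integrable_circleMeasure
          ((Complex.continuous_im.comp hGc).abs.rpow_const fun _ => Or.inr (by linarith))) hi
          fun t => abs_im_rpow_le_stripPotential hp (hre _ (hm t)) (him _ (hm t))
    _ = stripPotential p (Complex.sinh (Real.pi * G 0 / 2)) := he
    _ = stripPotential p (Real.sinh (Real.pi * (G 0).re / 2)) := by
        congr 1
        conv_lhs => rw [← Complex.re_add_im (G 0), hG0]
        push_cast
        simp
    _ ≤ _ := stripPotential_sinh_le hp (hre 0 h00)

namespace IsHardyOne

variable {F : ℂ → ℂ} {u v : UnitCircleAngle → ℝ}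

theorem integrable_re_boundary (hF : IsHardyOne F) (hb : HasRadialBoundaryValues F u v) :
    Integrable u circleMeasure := by
  simpa using (hF.integrable_boundary hb.hasSeqBoundaryValues).re

theorem integrable_im_boundary (hF : IsHardyOne F) (hb : HasRadialBoundaryValues F u v) :
    Integrable v circleMeasure := by
  simpa using (hF.integrable_boundary hb.hasSeqBoundaryValues).im

theorem eq_integral_re_im (hF : IsHardyOne F) (hb : HasRadialBoundaryValues F u v) {w : ℂ}
    (hw : ‖w‖ < 1) :
    F w = (∫ t, circlePoisson w t * u t ∂circleMeasure : ℝ)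
      + (∫ t, circlePoisson w t * v t ∂circleMeasure : ℝ) * Complex.I := by
  have hu := integrable_circlePoisson_mul (hF.integrable_re_boundary hb) hw
  have hv := integrable_circlePoisson_mul (hF.integrable_im_boundary hb) hw
  rw [hF.eq_integral_boundary hb.hasSeqBoundaryValues hw, ← integral_complex_ofReal,
    ← integral_complex_ofReal, ← integral_mul_const, ← integral_add hu.ofReal
    (hv.ofReal.mul_const _)]
  congr 1 with t
  push_cast
  ring

end IsHardyOne

namespace IsHalfStripFunction

variable {B : ℝ} {F : ℂ → ℂ} {u v : UnitCircleAngle → ℝ}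

theorem re_apply_nonneg (h : IsHalfStripFunction B F u v) {w : ℂ} (hw : ‖w‖ < 1) :
    0 ≤ (F w).re := by
  rw [h.hardy.eq_integral_re_im h.boundary hw]
  simp only [Complex.add_re, Complex.ofReal_re, Complex.mul_re, Complex.I_re, mul_zero,
    Complex.ofReal_im, zero_mul, sub_zero, add_zero]
  refine integral_nonneg_of_ae ?_
  filter_upwards [h.re_nonneg] with t ht using mul_nonneg (circlePoisson_nonneg hw t) ht

theorem abs_im_apply_le (h : IsHalfStripFunction B F u v) {w : ℂ} (hw : ‖w‖ < 1) :
    |(F w).im| ≤ B := by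
  have hv := IsHardyOne.integrable_circlePoisson_mul (h.hardy.integrable_im_boundary h.boundary) hw
  have e : (F w).im = ∫ t, circlePoisson w t * v t ∂circleMeasure := by
    rw [h.hardy.eq_integral_re_im h.boundary hw]; simp
  have hP := (continuous_circlePoisson hw).integrable_circleMeasure
  rw [e]
  calc _ ≤ ∫ t, |circlePoisson w t * v t| ∂circleMeasure := abs_integral_le_integral_abs
    _ ≤ ∫ t, circlePoisson w t * B ∂circleMeasure := by
        refine integral_mono_ae hv.abs (hP.mul_const _) ?_
        filter_upwards [h.im_bound] with t ht
        have h0 := circlePoisson_nonneg hw t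
        simp only [abs_mul, abs_of_nonneg h0]
        gcongr
    _ = B := by rw [integral_mul_const, integral_circlePoisson hw, one_mul]

theorem apply_zero (h : IsHalfStripFunction B F u v) :
    F 0 = (∫ t, u t ∂circleMeasure : ℝ) := by
  rw [h.hardy.eq_integral_re_im h.boundary (w := 0) (by simp)]
  simp [circlePoisson_zero, h.im_mean]

theorem bound_nonneg (h : IsHalfStripFunction B F u v) : 0 ≤ B := by
  obtain ⟨t, ht⟩ := h.im_bound.exists
  exact (abs_nonneg _).trans ht

theorem integral_abs_im_rpow_polarPoint_le (h : IsHalfStripFunction B F u v) {p : ℝ} (hp : 1 < p)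
    {r : ℝ} (h0 : 0 ≤ r) (h1 : r < 1) :
    ∫ t, |(F (polarPoint r t)).im| ^ p ∂circleMeasure
      ≤ sharpConst p * B ^ (p - 1) * ∫ t, u t ∂circleMeasure := by
  have hB := h.bound_nonneg
  set m := ∫ t, u t ∂circleMeasure with hm
  have main : ∀ δ > 0, ∫ t, |(F (polarPoint r t)).im| ^ p ∂circleMeasure
      ≤ sharpConst p * (B + δ) ^ (p - 1) * (m + δ) := by
    intro δ hδ
    have hBδ : 0 < B + δ := by linarith
    set k := (B + δ)⁻¹ with hk
    have hkpos : 0 < k := inv_pos.2 hBδ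
    -- Poisson representation only places `F` in the closed half strip. The shift by δ and division
    -- by B + δ make both inequalities strict, also when B = 0; afterwards δ → 0.
    let G : ℂ → ℂ := fun z => (k : ℂ) * (F z + δ)
    have hGre : ∀ z, (G z).re = k * ((F z).re + δ) := fun z => by simp [G]
    have hGim : ∀ z, (G z).im = k * (F z).im := fun z => by simp [G]
    have hmem : ∀ z ∈ Metric.ball (0 : ℂ) 1, ‖z‖ < 1 := fun z hz => by simpa using hz
    have := integral_abs_im_rpow_le hp (G := G)
      (analyticOnNhd_const.mul (h.hardy.analytic.add analyticOnNhd_const))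
      (fun z hz => by
        have := h.re_apply_nonneg (hmem z hz)
        rw [hGre]; positivity)
      (fun z hz => by
        have := h.abs_im_apply_le (hmem z hz)
        rw [hGim, abs_mul, abs_of_pos hkpos, hk, inv_mul_lt_iff₀ hBδ]
        linarith)
      (by rw [hGim, h.apply_zero]; simp) h0 h1
    simp only [hGre, hGim, abs_mul, abs_of_pos hkpos] at this
    simp only [Real.mul_rpow hkpos.le (abs_nonneg _), h.apply_zero, Complex.ofReal_re] at this
    rw [integral_const_mul, hk, Real.inv_rpow hBδ.le, inv_mul_le_iff₀ (by positivity)] at this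
    refine this.trans (le_of_eq ?_)
    rw [Real.rpow_sub_one hBδ.ne']
    rw [← hm]
    field_simp
  have hlim : Tendsto (fun δ : ℝ => sharpConst p * (B + δ) ^ (p - 1) * (m + δ)) (𝓝[>] 0)
      (𝓝 (sharpConst p * B ^ (p - 1) * m)) := by
    have hc : Continuous fun δ : ℝ => sharpConst p * (B + δ) ^ (p - 1) * (m + δ) := by
      have : Continuous fun δ : ℝ => (B + δ) ^ (p - 1) :=
        (Real.continuous_rpow_const (by linarith)).comp (continuous_const.add continuous_id)
      fun_prop
    have := hc.tendsto 0
    simp only [add_zero] at this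
    exact this.mono_left nhdsWithin_le_nhds
  exact ge_of_tendsto hlim (eventually_mem_nhdsWithin.mono fun δ hδ => main δ hδ)

theorem integrable_abs_im_rpow (h : IsHalfStripFunction B F u v) {p : ℝ} (hp : 1 < p) :
    Integrable (fun t => |v t| ^ p) circleMeasure := by
  have hm := (h.hardy.integrable_im_boundary h.boundary).aestronglyMeasurable
  refine (integrable_const (B ^ p)).mono' ?_ ?_
  · exact ((Real.continuous_rpow_const (by linarith)).comp continuous_abs).comp_aestronglyMeasurable
      hm
  · filter_upwards [h.im_bound] with t ht
    rw [Real.norm_eq_abs, abs_of_nonneg (by positivity)]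
    exact Real.rpow_le_rpow (abs_nonneg _) ht (by linarith)

theorem tendsto_integral_abs_im_rpow (h : IsHalfStripFunction B F u v) {p : ℝ} (hp : 1 < p) :
    Tendsto (fun n => ∫ t, |(F (polarPoint (radiusSeq n) t)).im| ^ p ∂circleMeasure) atTop
      (𝓝 (∫ t, |v t| ^ p ∂circleMeasure)) := by
  have hc : Continuous fun z : ℂ => |z.im| ^ p :=
    (Real.continuous_rpow_const (by linarith)).comp (continuous_abs.comp Complex.continuous_im)
  refine tendsto_integral_of_dominated_convergence (fun _ => B ^ p)
    (fun n => (hc.comp (h.hardy.continuous_comp_radiusSeq n)).aestronglyMeasurable)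
    (integrable_const _) (fun n => Eventually.of_forall fun t => ?_) ?_
  · rw [Real.norm_eq_abs, abs_of_nonneg (by positivity)]
    refine Real.rpow_le_rpow (abs_nonneg _) (h.abs_im_apply_le ?_) (by linarith)
    simpa using polarPoint_mem_ball (radiusSeq_nonneg n) (radiusSeq_lt_one n) t
  · filter_upwards [h.boundary.hasSeqBoundaryValues] with t ht
    have := (hc.tendsto _).comp ht
    simpa [Function.comp_def] using this

theorem integral_abs_im_rpow_le (h : IsHalfStripFunction B F u v) {p : ℝ} (hp : 1 < p) :
    ∫ t, |v t| ^ p ∂circleMeasure ≤ sharpConst p * B ^ (p - 1) * ∫ t, u t ∂circleMeasure :=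
  le_of_tendsto' (h.tendsto_integral_abs_im_rpow hp) fun n =>
    h.integral_abs_im_rpow_polarPoint_le hp (radiusSeq_nonneg n) (radiusSeq_lt_one n)

end IsHalfStripFunction

/-! ### The extremal map: disk to half plane to half strip -/

/-- The inverse hyperbolic sine on the closed right half plane. -/
noncomputable def halfPlaneArsinh (w : ℂ) : ℂ :=
  Complex.log (w + (w + Complex.I) ^ (2⁻¹ : ℂ) * (w - Complex.I) ^ (2⁻¹ : ℂ))

theorem cpow_half_mul_self (x : ℂ) : x ^ (2⁻¹ : ℂ) * x ^ (2⁻¹ : ℂ) = x := by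
  have := Complex.cpow_nat_inv_pow x (n := 2) two_ne_zero
  rwa [pow_two, Nat.cast_ofNat] at this

/-- The product has argument (arg x + arg y)/2, within [-π/2, π/2]. Splitting √(w²+1) into the two
roots of w ± i thus selects the branch with nonnegative real part on the whole closed half plane. -/
theorem re_cpow_half_mul_cpow_half_nonneg {x y : ℂ} (hx : 0 ≤ x.re) (hy : 0 ≤ y.re) :
    0 ≤ (x ^ (2⁻¹ : ℂ) * y ^ (2⁻¹ : ℂ)).re := by
  have h2 : (2⁻¹ : ℂ) ≠ 0 := by norm_num
  rcases eq_or_ne x 0 with rfl | hx0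
  · simp [Complex.zero_cpow h2]
  rcases eq_or_ne y 0 with rfl | hy0
  · simp [Complex.zero_cpow h2]
  rw [Complex.cpow_def_of_ne_zero hx0, Complex.cpow_def_of_ne_zero hy0, ← Complex.exp_add,
    Complex.exp_re]
  refine mul_nonneg (Real.exp_pos _).le (Real.cos_nonneg_of_mem_Icc ?_)
  have e : (Complex.log x * 2⁻¹ + Complex.log y * 2⁻¹).im = (x.arg + y.arg) / 2 := by
    rw [← add_mul, ← div_eq_mul_inv]
    simp [Complex.log_im]
  have a1 := abs_le.1 (Complex.abs_arg_le_pi_div_two_iff.2 hx)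
  have a2 := abs_le.1 (Complex.abs_arg_le_pi_div_two_iff.2 hy)
  rw [e]
  constructor <;> linarith

/-- Difference of squares: (w + i)(w - i) - w² = 1. It shows that the logarithm is taken of a
nonzero number and also identifies its reciprocal, which is what sinh needs. -/
theorem add_cpow_half_mul_inv (w : ℂ) :
    (w + (w + Complex.I) ^ (2⁻¹ : ℂ) * (w - Complex.I) ^ (2⁻¹ : ℂ)) *
      ((w + Complex.I) ^ (2⁻¹ : ℂ) * (w - Complex.I) ^ (2⁻¹ : ℂ) - w) = 1 := by
  have h1 := cpow_half_mul_self (w + Complex.I)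
  have h2 := cpow_half_mul_self (w - Complex.I)
  generalize (w + Complex.I) ^ (2⁻¹ : ℂ) = a at *
  generalize (w - Complex.I) ^ (2⁻¹ : ℂ) = b at *
  linear_combination b * b * h1 + (w + Complex.I) * h2 - Complex.I_sq

theorem halfPlaneArsinh_arg_mem_slitPlane {w : ℂ} (hw : 0 ≤ w.re) :
    w + (w + Complex.I) ^ (2⁻¹ : ℂ) * (w - Complex.I) ^ (2⁻¹ : ℂ) ∈ Complex.slitPlane := by
  have h := re_cpow_half_mul_cpow_half_nonneg (x := w + Complex.I) (y := w - Complex.I)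
    (by simpa using hw) (by simpa using hw)
  have hne := left_ne_zero_of_mul_eq_one (add_cpow_half_mul_inv w)
  set E := w + (w + Complex.I) ^ (2⁻¹ : ℂ) * (w - Complex.I) ^ (2⁻¹ : ℂ) with hE
  have hre : 0 ≤ E.re := by rw [hE, Complex.add_re]; positivity
  rcases hre.lt_or_eq with h1 | h1
  · exact Or.inl h1
  · exact Or.inr fun h2 => hne (Complex.ext h1.symm h2)

theorem abs_im_halfPlaneArsinh_le {w : ℂ} (hw : 0 ≤ w.re) :
    |(halfPlaneArsinh w).im| ≤ Real.pi / 2 := by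
  rw [halfPlaneArsinh, Complex.log_im, Complex.abs_arg_le_pi_div_two_iff, Complex.add_re]
  exact add_nonneg hw (re_cpow_half_mul_cpow_half_nonneg (by simpa using hw) (by simpa using hw))

theorem sinh_halfPlaneArsinh (w : ℂ) : Complex.sinh (halfPlaneArsinh w) = w := by
  have h := add_cpow_half_mul_inv w
  rw [halfPlaneArsinh, Complex.sinh, Complex.exp_neg, Complex.exp_log (left_ne_zero_of_mul_eq_one h),
    inv_eq_of_mul_eq_one_right h]
  ring

/-- The boundary is included, even the branch points ±i, where a power with exponent of positive
real part is still continuous at 0. -/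
theorem continuousAt_halfPlaneArsinh {w : ℂ} (hw : 0 ≤ w.re) : ContinuousAt halfPlaneArsinh w := by
  have h1 : ContinuousAt (fun w : ℂ => (w + Complex.I) ^ (2⁻¹ : ℂ)) w :=
    ContinuousAt.comp (f := fun w : ℂ => w + Complex.I)
      (Complex.continuousAt_cpow_const_of_re_pos (Or.inl (by simpa using hw)) (by norm_num))
      (by fun_prop)
  have h2 : ContinuousAt (fun w : ℂ => (w - Complex.I) ^ (2⁻¹ : ℂ)) w :=
    ContinuousAt.comp (f := fun w : ℂ => w - Complex.I)
      (Complex.continuousAt_cpow_const_of_re_pos (Or.inl (by simpa using hw)) (by norm_num))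
      (by fun_prop)
  exact ContinuousAt.clog (continuousAt_id.add (h1.mul h2)) (halfPlaneArsinh_arg_mem_slitPlane hw)

theorem analyticAt_halfPlaneArsinh {w : ℂ} (hw : 0 < w.re) : AnalyticAt ℂ halfPlaneArsinh w := by
  refine AnalyticAt.clog ?_ (halfPlaneArsinh_arg_mem_slitPlane hw.le)
  refine analyticAt_id.add (AnalyticAt.mul ?_ ?_)
  · exact (analyticAt_id.add analyticAt_const).cpow analyticAt_const (Or.inl (by simpa using hw))
  · exact (analyticAt_id.sub analyticAt_const).cpow analyticAt_const (Or.inl (by simpa using hw))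

theorem re_halfPlaneArsinh_pos {w : ℂ} (hw : 0 < w.re) : 0 < (halfPlaneArsinh w).re := by
  have h := Complex.sinh_re_eq_mul (halfPlaneArsinh w)
  rw [sinh_halfPlaneArsinh] at h
  have hcos := Real.cos_nonneg_of_mem_Icc (abs_le.1 (abs_im_halfPlaneArsinh_le hw.le))
  rw [h] at hw
  exact Real.sinh_pos_iff.1 (pos_of_mul_pos_left hw hcos)

theorem re_halfPlaneArsinh_ofReal_le {x : ℝ} (hx : 0 < x) :
    (halfPlaneArsinh x).im = 0 ∧ (halfPlaneArsinh x).re ≤ x := by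
  have hs := sinh_halfPlaneArsinh x
  have hre := re_halfPlaneArsinh_pos (w := x) (by simpa using hx)
  have h1 := Complex.sinh_re_eq_mul (halfPlaneArsinh x)
  have h2 := Complex.sinh_im_eq_mul (halfPlaneArsinh x)
  rw [hs, Complex.ofReal_re] at h1
  rw [hs, Complex.ofReal_im] at h2
  have hb := abs_le.1 (abs_im_halfPlaneArsinh_le (w := x) (by simpa using hx.le))
  have hpi := Real.pi_pos
  have him : (halfPlaneArsinh x).im = 0 := by
    rcases mul_eq_zero.1 h2.symm with h | h
    · exact absurd h (Real.cosh_pos _).ne'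
    · exact (Real.sin_eq_zero_iff_of_lt_of_lt (by linarith) (by linarith)).1 h
  refine ⟨him, ?_⟩
  rw [him, Real.cos_zero, mul_one] at h1
  exact (Real.self_le_sinh_iff.2 hre.le).trans_eq h1.symm

/-- The conformal map of the disk onto the right half plane with `0 ↦ ε`. -/
noncomputable def diskToHalfPlane (ε : ℝ) (z : ℂ) : ℂ := ε * ((1 + z) / (1 - z))

theorem re_diskToHalfPlane (ε : ℝ) (z : ℂ) :
    (diskToHalfPlane ε z).re = ε * ((1 - ‖z‖ ^ 2) / ‖1 - z‖ ^ 2) := by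
  rw [diskToHalfPlane, Complex.re_ofReal_mul, Complex.div_re, ← Complex.normSq_eq_norm_sq z,
    Complex.normSq_eq_norm_sq (1 - z), ← add_div, Complex.normSq_apply]
  simp
  ring_nf
  simp

theorem diskToHalfPlane_zero (ε : ℝ) : diskToHalfPlane ε 0 = ε := by simp [diskToHalfPlane]

theorem re_diskToHalfPlane_pos {ε : ℝ} (hε : 0 < ε) {z : ℂ} (hz : z ∈ Metric.ball (0 : ℂ) 1) :
    0 < (diskToHalfPlane ε z).re := by
  have h1 : ‖z‖ < 1 := by simpa using hz
  have h2 : 1 - z ≠ 0 := fun h => by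
    rw [← sub_eq_zero.1 h] at h1; simp at h1
  rw [re_diskToHalfPlane]
  have h3 : 0 < 1 - ‖z‖ ^ 2 := by nlinarith [norm_nonneg z]
  have h4 : 0 < ‖1 - z‖ := norm_pos_iff.2 h2
  positivity

theorem analyticAt_diskToHalfPlane (ε : ℝ) {z : ℂ} (hz : z ≠ 1) :
    AnalyticAt ℂ (diskToHalfPlane ε) z := by
  have : 1 - z ≠ 0 := sub_ne_zero.2 hz.symm
  unfold diskToHalfPlane
  fun_prop (disch := assumption)

theorem analyticOnNhd_diskToHalfPlane (ε : ℝ) :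
    AnalyticOnNhd ℂ (diskToHalfPlane ε) (Metric.ball 0 1) := fun z hz =>
  analyticAt_diskToHalfPlane ε fun h => by rw [h] at hz; simp at hz

theorem re_diskToHalfPlane_polarPoint_one (ε : ℝ) (t : UnitCircleAngle) :
    (diskToHalfPlane ε (polarPoint 1 t)).re = 0 := by
  simp [re_diskToHalfPlane, norm_polarPoint]

theorem ae_polarPoint_one_ne_one : ∀ᵐ t ∂circleMeasure, polarPoint 1 t ≠ 1 := by
  have : Fact (0 < 2 * Real.pi) := ⟨Real.two_pi_pos⟩
  have h0 : ∀ s : UnitCircleAngle, polarPoint 1 s = 1 → s = 0 := fun s hs => by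
    apply AddCircle.injective_toCircle (T := 2 * Real.pi) Real.two_pi_pos.ne'
    rw [AddCircle.toCircle_zero]
    ext
    simpa [polarPoint] using hs
  have hsub : {t : UnitCircleAngle | ¬ polarPoint 1 t ≠ 1} ⊆ {0} := fun s hs => by
    simpa using h0 s (not_not.1 hs)
  refine measure_mono_null hsub ?_
  have : Nontrivial Circle := ⟨1, Circle.exp Real.pi, fun h => by
    have h' := congrArg (fun z : Circle => (z : ℂ).re) h
    norm_num [Circle.coe_exp, Complex.exp_pi_mul_I] at h'⟩
  have : Nontrivial (AddCircle (2 * Real.pi)) :=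
    (AddCircle.homeomorphCircle (T := 2 * Real.pi) (by positivity)).toEquiv.nontrivial
  change AddCircle.haarAddCircle {0} = 0
  exact measure_singleton _

theorem tendsto_polarPoint_nhdsLT (t : UnitCircleAngle) :
    Tendsto (fun r : ℝ => polarPoint r t) (𝓝[<] 1) (𝓝 (polarPoint 1 t)) := by
  have : Continuous fun r : ℝ => polarPoint r t := by unfold polarPoint; fun_prop
  exact (this.tendsto 1).mono_left nhdsWithin_le_nhds

/-- The conformal map of the disk onto the half strip of half-width `B` with
`F(0) = (2 B / π) arsinh ε`. -/
noncomputable def diskToHalfStrip (B ε : ℝ) (z : ℂ) : ℂ :=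
  (B * (2 / Real.pi) : ℝ) * halfPlaneArsinh (diskToHalfPlane ε z)

theorem isHalfStripFunction_diskToHalfStrip {B ε : ℝ} (hB : 0 < B) (hε : 0 < ε) :
    IsHalfStripFunction B (diskToHalfStrip B ε)
      (fun t => (diskToHalfStrip B ε (polarPoint 1 t)).re)
      (fun t => (diskToHalfStrip B ε (polarPoint 1 t)).im) := by
  have hpi := Real.pi_pos
  have hk : 0 < B * (2 / Real.pi) := by positivity
  have hre : ∀ z, (diskToHalfStrip B ε z).re
      = B * (2 / Real.pi) * (halfPlaneArsinh (diskToHalfPlane ε z)).re :=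
    fun z => Complex.re_ofReal_mul _ _
  have him : ∀ z, (diskToHalfStrip B ε z).im
      = B * (2 / Real.pi) * (halfPlaneArsinh (diskToHalfPlane ε z)).im :=
    fun z => Complex.im_ofReal_mul _ _
  have hanal : AnalyticOnNhd ℂ (diskToHalfStrip B ε) (Metric.ball 0 1) := fun z hz =>
    analyticAt_const.mul ((analyticAt_halfPlaneArsinh (re_diskToHalfPlane_pos hε hz)).comp
      (analyticOnNhd_diskToHalfPlane ε z hz))
  have him_le : ∀ z, 0 ≤ (diskToHalfPlane ε z).re → |(diskToHalfStrip B ε z).im| ≤ B := by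
    intro z hz
    rw [him, abs_mul, abs_of_pos hk]
    calc _ ≤ B * (2 / Real.pi) * (Real.pi / 2) := by
          gcongr; exact abs_im_halfPlaneArsinh_le hz
      _ = B := by field_simp
  have hre_pos : ∀ z ∈ Metric.ball (0 : ℂ) 1, 0 < (diskToHalfStrip B ε z).re := fun z hz => by
    rw [hre]; exact mul_pos hk (re_halfPlaneArsinh_pos (re_diskToHalfPlane_pos hε hz))
  have hardy : IsHardyOne (diskToHalfStrip B ε) := by
    -- Here |F| ≤ Re F + B, and the harmonic function Re F has mean Re F(0) on every circle.
    refine ⟨hanal, (diskToHalfStrip B ε 0).re + B, fun r h0 h1 => ?_⟩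
    have hc := hanal.continuous_comp_polarPoint h0 h1
    have hi := hc.integrable_circleMeasure
    have e := integral_re hi
    rw [circleMean_eq_of_analyticOnNhd hanal h0 h1] at e
    simp only [RCLike.re_to_complex] at e
    have hri : Integrable (fun t => (diskToHalfStrip B ε (polarPoint r t)).re) circleMeasure := hi.re
    calc _ ≤ ∫ t, ((diskToHalfStrip B ε (polarPoint r t)).re + B) ∂circleMeasure := by
          refine integral_mono hi.norm (hri.add (integrable_const B)) fun t => ?_
          have hm := polarPoint_mem_ball h0 h1 t
          refine (Complex.norm_le_abs_re_add_abs_im _).trans ?_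
          rw [abs_of_pos (hre_pos _ hm)]
          gcongr
          exact him_le _ (re_diskToHalfPlane_pos hε hm).le
      _ = _ := by rw [integral_add hri (integrable_const B), e]; simp
  -- The only exceptional boundary point is 1, the pole of the Cayley map.
  have hlim : ∀ t, polarPoint 1 t ≠ 1 →
      Tendsto (fun r : ℝ => diskToHalfStrip B ε (polarPoint r t)) (𝓝[<] 1)
        (𝓝 (diskToHalfStrip B ε (polarPoint 1 t))) := fun t ht => by
    have h1 : ContinuousAt (diskToHalfStrip B ε) (polarPoint 1 t) :=
      continuousAt_const.mul (ContinuousAt.comp (f := diskToHalfPlane ε)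
        (continuousAt_halfPlaneArsinh (re_diskToHalfPlane_polarPoint_one ε t).ge)
        (analyticAt_diskToHalfPlane ε ht).continuousAt)
    exact h1.tendsto.comp (tendsto_polarPoint_nhdsLT t)
  have hbd : HasRadialBoundaryValues (diskToHalfStrip B ε)
      (fun t => (diskToHalfStrip B ε (polarPoint 1 t)).re)
      (fun t => (diskToHalfStrip B ε (polarPoint 1 t)).im) := by
    filter_upwards [ae_polarPoint_one_ne_one] with t ht
    rw [Complex.re_add_im]
    exact hlim t ht
  refine ⟨hardy, hbd, ?_, Eventually.of_forall fun t =>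
    him_le _ (re_diskToHalfPlane_polarPoint_one ε t).ge, ?_⟩
  · filter_upwards [ae_polarPoint_one_ne_one] with t ht
    refine ge_of_tendsto ((Complex.continuous_re.tendsto _).comp (hlim t ht)) ?_
    filter_upwards [Ioo_mem_nhdsLT (zero_lt_one' ℝ)] with r hr
    exact (hre_pos _ (polarPoint_mem_ball hr.1.le hr.2 t)).le
  · have h0 := congrArg Complex.im (hardy.eq_integral_re_im hbd (w := 0) (by simp))
    rw [him, diskToHalfPlane_zero, (re_halfPlaneArsinh_ofReal_le hε).1] at h0
    simpa [circlePoisson_zero] using h0.symm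

/-! ### Boundary values of the potential -/

theorem rayMeasure_mul_I_of_lt {c σ : ℝ} (hc : 0 ≤ c) (h : c < |σ|) :
    rayMeasure c (σ * Complex.I) = 1 := by
  rw [rayMeasure, ← sub_mul, ← add_mul, ← Complex.ofReal_sub, ← Complex.ofReal_add]
  rcases lt_abs.1 h with h | h
  · rw [Complex.arg_eq_pi_div_two_iff.2 ⟨by simp, by simp; linarith⟩,
      Complex.arg_eq_pi_div_two_iff.2 ⟨by simp, by simp; linarith⟩]
    simp
  · rw [Complex.arg_eq_neg_pi_div_two_iff.2 ⟨by simp, by simp; linarith⟩,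
      Complex.arg_eq_neg_pi_div_two_iff.2 ⟨by simp, by simp; linarith⟩]
    simp

theorem rayMeasure_mul_I_of_gt {c σ : ℝ} (h : |σ| < c) :
    rayMeasure c (σ * Complex.I) = 0 := by
  have h' := abs_lt.1 h
  rw [rayMeasure, ← sub_mul, ← add_mul, ← Complex.ofReal_sub, ← Complex.ofReal_add,
    Complex.arg_eq_neg_pi_div_two_iff.2 ⟨by simp, by simp; linarith⟩,
    Complex.arg_eq_pi_div_two_iff.2 ⟨by simp, by simp; linarith⟩]
  have hpi := Real.pi_ne_zero
  field_simp
  ring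

theorem continuousAt_rayMeasure_mul_I {c σ : ℝ} (hc : 0 ≤ c) (h : |σ| ≠ c) :
    ContinuousAt (rayMeasure c) (σ * Complex.I) := by
  have hne : σ - c ≠ 0 ∧ σ + c ≠ 0 := by
    constructor <;> intro h0 <;> apply h
    · rw [sub_eq_zero.1 h0, abs_of_nonneg hc]
    · rw [eq_neg_of_add_eq_zero_left h0, abs_neg, abs_of_nonneg hc]
  have h1 : ContinuousAt (fun w : ℂ => (w - c * Complex.I).arg) (σ * Complex.I) :=
    ContinuousAt.comp (f := fun w : ℂ => w - c * Complex.I)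
      (Complex.continuousAt_arg (Or.inr (by simpa using hne.1))) (by fun_prop)
  have h2 : ContinuousAt (fun w : ℂ => (w + c * Complex.I).arg) (σ * Complex.I) :=
    ContinuousAt.comp (f := fun w : ℂ => w + c * Complex.I)
      (Complex.continuousAt_arg (Or.inr (by simpa using hne.2))) (by fun_prop)
  exact continuousAt_const.add ((h1.sub h2).div_const _)

theorem stripPotential_mem_Icc {p : ℝ} (hp : 1 < p) {w : ℂ} (hw : 0 < w.re) :
    stripPotential p w ∈ Set.Icc 0 1 := by
  have hsin : Continuous fun t : ℝ => Real.sin (Real.pi * t / 2) := by fun_prop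
  have hc := continuous_rayMeasure (continuous_const (y := w)) hsin fun _ => hw
  have hk := continuous_rpow_weight hp
  constructor
  · refine intervalIntegral.integral_nonneg zero_le_one fun t ht => ?_
    have := rayMeasure_nonneg hw (Real.sin (Real.pi * t / 2))
    have := Real.rpow_nonneg ht.1 (p - 1)
    positivity
  · rw [← Real.one_rpow p, ← integral_rpow_weight hp 1]
    refine intervalIntegral.integral_mono_on zero_le_one ((hk.mul hc).intervalIntegrable _ _)
      (hk.intervalIntegrable _ _) fun t ht => ?_
    have h1 := rayMeasure_le_one hw (ht.1.trans (le_sin_pi_mul_div_two ht))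
    have h2 := Real.rpow_nonneg ht.1 (p - 1)
    exact mul_le_of_le_one_right (by positivity) h1

theorem integral_rpow_weight_mul_indicator {p : ℝ} (hp : 1 < p) {y : ℝ} (hy0 : 0 ≤ y)
    (hy : y ≤ 1) :
    ∫ t in (0 : ℝ)..1, p * t ^ (p - 1) * (if t ≤ y then 1 else 0) = y ^ p := by
  have hk := continuous_rpow_weight hp
  have h : ∀ t : ℝ, p * t ^ (p - 1) * (if t ≤ y then 1 else 0)
      = (Set.Iic y).indicator (fun t => p * t ^ (p - 1)) t := fun t => by
    by_cases ht : t ≤ y <;> simp [ht]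
  simp_rw [h]
  rw [← integral_rpow_weight hp y, intervalIntegral.integral_of_le zero_le_one,
    intervalIntegral.integral_of_le hy0, setIntegral_indicator measurableSet_Iic,
    Set.Ioc_inter_Iic, inf_eq_right.2 hy]

/-- `stripPotential p` has boundary values `|Im g| ^ p` at `sinh (π g / 2)` for `g` on the boundary
of the half strip. -/
theorem tendsto_stripPotential {p : ℝ} (hp : 1 < p) {g : ℂ} (hg : |g.im| ≤ 1)
    (hre : (Complex.sinh (Real.pi * g / 2)).re = 0) {w : ℕ → ℂ} (hw : ∀ n, 0 < (w n).re)
    (hlim : Tendsto w atTop (𝓝 (Complex.sinh (Real.pi * g / 2)))) :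
    Tendsto (fun n => stripPotential p (w n)) atTop (𝓝 (|g.im| ^ p)) := by
  have hpi := Real.pi_pos
  set σ := (Complex.sinh (Real.pi * g / 2)).im with hσ
  have hσI : Complex.sinh (Real.pi * g / 2) = σ * Complex.I := by
    apply Complex.ext <;> simp [hre, hσ]
  have e1 : (Real.pi * g / 2 : ℂ).re = Real.pi * g.re / 2 := by simp
  have e2 : (Real.pi * g / 2 : ℂ).im = Real.pi * g.im / 2 := by simp
  rw [Complex.sinh_re_eq_mul, e1, e2] at hre
  rw [Complex.sinh_im_eq_mul, e1, e2] at hσ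
  have hsinabs : |Real.sin (Real.pi * g.im / 2)| = Real.sin (Real.pi * |g.im| / 2) := by
    rcases le_total 0 g.im with h | h
    · rw [abs_of_nonneg h] at hg ⊢
      exact abs_of_nonneg (h.trans (le_sin_pi_mul_div_two ⟨h, hg⟩))
    · rw [abs_of_nonpos h] at hg ⊢
      rw [show Real.pi * g.im / 2 = -(Real.pi * (-g.im) / 2) by ring, Real.sin_neg, abs_neg]
      exact abs_of_nonneg ((neg_nonneg.2 h).trans (le_sin_pi_mul_div_two ⟨neg_nonneg.2 h, hg⟩))
  have hmono : ∀ a b : ℝ, 0 ≤ a → a < b → b ≤ 1 →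
      Real.sin (Real.pi * a / 2) < Real.sin (Real.pi * b / 2) := by
    intro a b ha hab hb
    apply Real.sin_lt_sin_of_lt_of_le_pi_div_two
    · have : 0 ≤ Real.pi * a / 2 := by positivity
      linarith
    · nlinarith
    · gcongr
  have habs : |σ| = Real.cosh (Real.pi * g.re / 2) * Real.sin (Real.pi * |g.im| / 2) := by
    rw [hσ, abs_mul, abs_of_pos (Real.cosh_pos _), hsinabs]
  have hlow : ∀ t, 0 ≤ t → t < |g.im| → Real.sin (Real.pi * t / 2) < |σ| := by
    intro t ht hty
    rw [habs]
    have h1 := hmono t _ ht hty hg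
    have h2 := ht.trans (le_sin_pi_mul_div_two ⟨ht, hty.le.trans hg⟩)
    nlinarith [Real.one_le_cosh (Real.pi * g.re / 2)]
  -- Such t exist only off the horizontal sides. There cos(π Im g / 2) > 0, so a vanishing real part
  -- of the sinh forces Re g = 0, the vertical side, where |σ| = sin(π|Im g|/2).
  have hhigh : ∀ t, |g.im| < t → t ≤ 1 → |σ| < Real.sin (Real.pi * t / 2) := by
    intro t hty ht
    have hlt : |Real.pi * g.im / 2| < Real.pi / 2 := by
      rw [abs_div, abs_mul, abs_of_pos hpi, abs_two]
      gcongr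
      nlinarith
    have hcos := Real.cos_pos_of_mem_Ioo (abs_lt.1 hlt)
    have h0 : Real.pi * g.re / 2 = 0 := by
      rcases mul_eq_zero.1 hre with h | h
      · exact Real.sinh_eq_zero.1 h
      · exact absurd h hcos.ne'
    rw [habs, h0, Real.cosh_zero, one_mul]
    exact hmono _ _ (abs_nonneg _) hty ht
  rw [← integral_rpow_weight_mul_indicator hp (abs_nonneg _) hg]
  have hsin : Continuous fun t : ℝ => Real.sin (Real.pi * t / 2) := by fun_prop
  have hk := continuous_rpow_weight hp
  refine intervalIntegral.tendsto_integral_filter_of_dominated_convergence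
    (fun t => p * t ^ (p - 1)) (Eventually.of_forall fun n =>
      (hk.mul (continuous_rayMeasure continuous_const hsin fun _ => hw n)).aestronglyMeasurable)
    (Eventually.of_forall fun n => Eventually.of_forall fun t ht => ?_)
    (hk.intervalIntegrable _ _) ?_
  · rw [Set.uIoc_of_le zero_le_one] at ht
    have h1 := rayMeasure_le_one (hw n) (ht.1.le.trans (le_sin_pi_mul_div_two ⟨ht.1.le, ht.2⟩))
    have h2 := Real.rpow_nonneg ht.1.le (p - 1)
    have h3 := rayMeasure_nonneg (hw n) (Real.sin (Real.pi * t / 2))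
    rw [Real.norm_eq_abs, abs_of_nonneg (by positivity)]
    exact mul_le_of_le_one_right (by positivity) h1
  -- At t = |Im g| the boundary point may be an endpoint of the rays, where the ray measure has no
  -- limit.
  · have hne : ∀ᵐ t : ℝ, t ≠ |g.im| := by simp [ae_iff]
    filter_upwards [hne] with t ht0 ht
    rw [Set.uIoc_of_le zero_le_one] at ht
    refine tendsto_const_nhds.mul ?_
    have hs0 := ht.1.le.trans (le_sin_pi_mul_div_two ⟨ht.1.le, ht.2⟩)
    rw [hσI] at hlim
    rcases lt_or_gt_of_ne ht0 with h | h
    · have hs := hlow t ht.1.le h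
      rw [if_pos h.le, ← rayMeasure_mul_I_of_lt hs0 hs]
      exact (continuousAt_rayMeasure_mul_I hs0 hs.ne').tendsto.comp hlim
    · have hs := hhigh t h ht.2
      rw [if_neg (not_le.2 h), ← rayMeasure_mul_I_of_gt hs]
      exact (continuousAt_rayMeasure_mul_I hs0 hs.ne).tendsto.comp hlim

/-! ### Slope at the origin and sharpness -/

theorem Real.arctan_le_self_of_nonneg {x : ℝ} (hx : 0 ≤ x) : Real.arctan x ≤ x := by
  have h := Real.le_tan (Real.arctan_nonneg.2 hx) (Real.arctan_lt_pi_div_two x)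
  rwa [Real.tan_arctan] at h

/-- The slope of `stripPotential p` at the origin. -/
theorem tendsto_stripPotential_div {p : ℝ} (hp : 1 < p) :
    Tendsto (fun ε : ℝ => stripPotential p ε * (Real.pi / (2 * ε))) (𝓝[>] 0)
      (𝓝 (sharpConst p)) := by
  have hpi := Real.pi_pos
  have h1 : Tendsto (fun ε : ℝ => ∫ t in (0 : ℝ)..1,
      p * (t ^ (p - 1) * (ε⁻¹ * Real.arctan (ε / Real.sin (Real.pi * t / 2))))) (𝓝[>] 0)
      (𝓝 (∫ t in (0 : ℝ)..1, p * (t ^ (p - 1) / Real.sin (Real.pi * t / 2)))) := by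
    -- The difference quotients of arctan(·/c) tend to 1/c and are bounded by it, so the integrand
    -- of A_p is both limit and dominating function.
    refine intervalIntegral.tendsto_integral_filter_of_dominated_convergence
      (fun t => p * (t ^ (p - 1) / Real.sin (Real.pi * t / 2)))
      (Eventually.of_forall fun ε => Measurable.aestronglyMeasurable (by fun_prop)) ?_
      ((intervalIntegrable_sharpConst hp).const_mul p) (Eventually.of_forall fun t ht => ?_)
    · filter_upwards [self_mem_nhdsWithin] with ε hε
      refine Eventually.of_forall fun t ht => ?_
      rw [Set.uIoc_of_le zero_le_one] at ht
      have hε' : 0 < ε := hε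
      have hc := ht.1.trans_le (le_sin_pi_mul_div_two ⟨ht.1.le, ht.2⟩)
      have h2 := Real.rpow_nonneg ht.1.le (p - 1)
      have h3 := Real.arctan_nonneg.2 (div_pos hε' hc).le
      rw [Real.norm_eq_abs, abs_of_nonneg (by positivity), div_eq_mul_inv (t ^ (p - 1))]
      gcongr
      rw [inv_mul_le_iff₀ hε', ← div_eq_mul_inv]
      exact Real.arctan_le_self_of_nonneg (div_pos hε' hc).le
    · rw [Set.uIoc_of_le zero_le_one] at ht
      have hc := ht.1.trans_le (le_sin_pi_mul_div_two ⟨ht.1.le, ht.2⟩)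
      set c := Real.sin (Real.pi * t / 2)
      have hd : HasDerivAt (fun x : ℝ => Real.arctan (x / c)) (1 / c) 0 := by
        simpa using ((hasDerivAt_id (0 : ℝ)).div_const c).arctan
      have := hd.tendsto_slope_zero_right
      simp only [zero_add, zero_div, Real.arctan_zero, sub_zero, smul_eq_mul] at this
      rw [div_eq_mul_one_div (t ^ (p - 1))]
      exact (this.const_mul _).const_mul _
  rw [intervalIntegral.integral_const_mul] at h1
  refine h1.congr' ?_
  filter_upwards [self_mem_nhdsWithin] with ε hε
  have hε' : 0 < ε := hε
  rw [stripPotential, ← intervalIntegral.integral_mul_const]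
  refine intervalIntegral.integral_congr_ae (Eventually.of_forall fun t ht => ?_)
  rw [Set.uIoc_of_le zero_le_one] at ht
  have hc := ht.1.trans_le (le_sin_pi_mul_div_two ⟨ht.1.le, ht.2⟩)
  rw [rayMeasure_ofReal hc hε']
  field_simp

theorem sharpConst_pos {p : ℝ} (hp : 1 < p) : 0 < sharpConst p := by
  have hk := continuous_rpow_weight hp
  have h : ∫ t in (0 : ℝ)..1, p * t ^ (p - 1) ≤ sharpConst p := by
    rw [sharpConst, ← intervalIntegral.integral_const_mul]
    refine intervalIntegral.integral_mono_on_of_le_Ioo zero_le_one (hk.intervalIntegrable _ _)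
      ((intervalIntegrable_sharpConst hp).const_mul p) fun t ht => ?_
    have hc := ht.1.trans_le (le_sin_pi_mul_div_two ⟨ht.1.le, ht.2.le⟩)
    gcongr
    exact le_div_self (Real.rpow_nonneg ht.1.le _) hc (Real.sin_le_one _)
  rw [integral_rpow_weight hp, Real.one_rpow] at h
  linarith

/-- Along the Cayley map the potential has circle means Φ(ε) for every r < 1, lies in [0, 1], and
tends to |v/B|^p almost everywhere; bounded convergence gives equality. -/
theorem integral_abs_im_rpow_diskToHalfStrip {p B ε : ℝ} (hp : 1 < p) (hB : 0 < B) (hε : 0 < ε) :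
    ∫ t, |(diskToHalfStrip B ε (polarPoint 1 t)).im| ^ p ∂circleMeasure
      = B ^ p * stripPotential p ε := by
  have hpi := Real.pi_pos
  let G : UnitCircleAngle → ℂ := fun t =>
    (2 / Real.pi : ℝ) * halfPlaneArsinh (diskToHalfPlane ε (polarPoint 1 t))
  have hGim : ∀ t, (G t).im
      = 2 / Real.pi * (halfPlaneArsinh (diskToHalfPlane ε (polarPoint 1 t))).im :=
    fun t => Complex.im_ofReal_mul _ _
  have hGle : ∀ t, |(G t).im| ≤ 1 := fun t => by
    rw [hGim, abs_mul, abs_of_pos (by positivity : 0 < 2 / Real.pi)]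
    calc _ ≤ 2 / Real.pi * (Real.pi / 2) := by
          gcongr
          exact abs_im_halfPlaneArsinh_le (re_diskToHalfPlane_polarPoint_one ε t).ge
      _ = 1 := by field_simp
  have hsinh : ∀ t, Complex.sinh (Real.pi * G t / 2) = diskToHalfPlane ε (polarPoint 1 t) := by
    intro t
    have : (Real.pi * G t / 2 : ℂ) = halfPlaneArsinh (diskToHalfPlane ε (polarPoint 1 t)) := by
      have : (Real.pi : ℂ) ≠ 0 := by exact_mod_cast hpi.ne'
      simp only [G]
      push_cast
      field_simp
    rw [this, sinh_halfPlaneArsinh]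
  have hmem := fun n t => polarPoint_mem_ball (radiusSeq_nonneg n) (radiusSeq_lt_one n) t
  have hmean := fun n => circleMean_stripPotential hp (analyticOnNhd_diskToHalfPlane ε)
    (fun z hz => re_diskToHalfPlane_pos hε hz) (radiusSeq_nonneg n) (radiusSeq_lt_one n)
  have hlim : Tendsto (fun n => ∫ t, stripPotential p
      (diskToHalfPlane ε (polarPoint (radiusSeq n) t)) ∂circleMeasure) atTop
      (𝓝 (∫ t, |(G t).im| ^ p ∂circleMeasure)) := by
    refine tendsto_integral_of_dominated_convergence (fun _ => 1)
      (fun n => (hmean n).1.aestronglyMeasurable) (integrable_const _)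
      (fun n => Eventually.of_forall fun t => ?_) ?_
    · have := stripPotential_mem_Icc hp (re_diskToHalfPlane_pos hε (hmem n t))
      rw [Real.norm_eq_abs, abs_of_nonneg this.1]
      exact this.2
    · filter_upwards [ae_polarPoint_one_ne_one] with t ht
      refine tendsto_stripPotential hp (hGle t) ?_
        (fun n => re_diskToHalfPlane_pos hε (hmem n t)) ?_
      · rw [hsinh, re_diskToHalfPlane_polarPoint_one]
      · rw [hsinh]
        exact (analyticAt_diskToHalfPlane ε ht).continuousAt.tendsto.comp
          ((tendsto_polarPoint_nhdsLT t).comp tendsto_radiusSeq_nhdsLT)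
  have hval : ∫ t, |(G t).im| ^ p ∂circleMeasure = stripPotential p ε := by
    refine tendsto_nhds_unique hlim ?_
    simp_rw [fun n => (hmean n).2, diskToHalfPlane_zero]
    exact tendsto_const_nhds
  rw [← hval, ← integral_const_mul]
  congr 1 with t
  have : (diskToHalfStrip B ε (polarPoint 1 t)).im = B * (G t).im := by
    rw [hGim, diskToHalfStrip, Complex.im_ofReal_mul, mul_assoc]
  rw [this, abs_mul, abs_of_pos hB, Real.mul_rpow hB.le (abs_nonneg _)]

theorem integral_re_diskToHalfStrip_le {B ε : ℝ} (hB : 0 < B) (hε : 0 < ε) :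
    ∫ t, (diskToHalfStrip B ε (polarPoint 1 t)).re ∂circleMeasure ≤ B * (2 * ε / Real.pi) := by
  have hpi := Real.pi_pos
  have h := congrArg Complex.re (isHalfStripFunction_diskToHalfStrip hB hε).apply_zero
  rw [Complex.ofReal_re] at h
  rw [← h, diskToHalfStrip, Complex.re_ofReal_mul, diskToHalfPlane_zero, mul_assoc, mul_comm 2 ε,
    mul_div_assoc, mul_comm ε]
  gcongr
  exact (re_halfPlaneArsinh_ofReal_le hε).2

theorem exists_isHalfStripFunction_lt {p B C : ℝ} (hp : 1 < p) (hB : 0 < B)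
    (hC : C < sharpConst p) :
    ∃ (F : ℂ → ℂ) (u v : UnitCircleAngle → ℝ), IsHalfStripFunction B F u v ∧
      C * B ^ (p - 1) * ∫ t, u t ∂circleMeasure < ∫ t, |v t| ^ p ∂circleMeasure := by
  have hpi := Real.pi_pos
  -- Replacing C by its positive part lets the upper bound ∫u ≤ 2Bε/π, from arsinh ε ≤ ε, be
  -- multiplied through.
  have hC' : max C 0 < sharpConst p := max_lt hC (sharpConst_pos hp)
  obtain ⟨ε, hlt, hε⟩ := (((tendsto_stripPotential_div hp).eventually_const_lt hC').and
    self_mem_nhdsWithin).exists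
  have hε : 0 < ε := hε
  have hF := isHalfStripFunction_diskToHalfStrip hB hε
  refine ⟨_, _, _, hF, ?_⟩
  rw [integral_abs_im_rpow_diskToHalfStrip hp hB hε]
  have hu0 : 0 ≤ ∫ t, (diskToHalfStrip B ε (polarPoint 1 t)).re ∂circleMeasure :=
    integral_nonneg_of_ae hF.re_nonneg
  have hlt' : max C 0 * (2 * ε / Real.pi) < stripPotential p ε := by
    have e : max C 0 = max C 0 * (2 * ε / Real.pi) * (Real.pi / (2 * ε)) := by field_simp
    rw [e] at hlt
    exact lt_of_mul_lt_mul_right hlt (by positivity)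
  calc _ ≤ max C 0 * B ^ (p - 1) * (B * (2 * ε / Real.pi)) := by
        have := le_max_left C 0
        have := le_max_right C 0
        refine mul_le_mul ?_ (integral_re_diskToHalfStrip_le hB hε) hu0 (by positivity)
        gcongr
    _ = B ^ p * (max C 0 * (2 * ε / Real.pi)) := by
        rw [Real.rpow_sub_one hB.ne']
        field_simp
    _ < _ := by gcongr

theorem mainTheorem1 (p : ℝ) (hp : 1 < p) :
    -- the integral defining the constant converges
    IntervalIntegrable (fun t : ℝ => t ^ (p - 1) / Real.sin (Real.pi * t / 2)) volume 0 1 ∧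
    -- the inequality
    (∀ (B : ℝ) (F : ℂ → ℂ) (u v : UnitCircleAngle → ℝ), IsHalfStripFunction B F u v →
      Integrable u circleMeasure ∧
      Integrable (fun t => |v t| ^ p) circleMeasure ∧
      ∫ t, |v t| ^ p ∂circleMeasure
        ≤ sharpConst p * B ^ (p - 1) * ∫ t, u t ∂circleMeasure) ∧
    -- no smaller constant works, for any given bound
    (∀ (B : ℝ), 0 < B → ∀ C : ℝ, C < sharpConst p →
      ∃ (F : ℂ → ℂ) (u v : UnitCircleAngle → ℝ), IsHalfStripFunction B F u v ∧
        C * B ^ (p - 1) * ∫ t, u t ∂circleMeasure < ∫ t, |v t| ^ p ∂circleMeasure) :=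
  ⟨intervalIntegrable_sharpConst hp,
    fun _ _ _ _ h => ⟨h.hardy.integrable_re_boundary h.boundary, h.integrable_abs_im_rpow hp,
      h.integral_abs_im_rpow_le hp⟩,
    fun _ hB _ hC => exists_isHalfStripFunction_lt hp hB hC⟩
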